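/- **Setting.** Let $N\ge 2$ and $\mathcal N=\{1,\dots,N\}$. Player $i$ has action $x_i\in\mathbb R$ and cost $f_i:\mathbb R^N\to\mathbb R$, and its dynamics are $\dot x_i=u_i+g_i(\mathbf x)+d_i(t)$ for $t\ge t_0$. Assume: (1) each $f_i$ is twice continuously differentiable; (2) there is $m>0$ with $(\mathbf x-\mathbf z)^T(\Upsilon(\mathbf x)-\Upsilon(\mathbf z))\ge m\|\mathbf x-\mathbf z\|^2$ for all $\mathbf x,\mathbf z\in\mathbb R^N$, where $\Upsilon(\mathbf x)=(\frac{\partial f_1}{\partial x_1}(\mathbf x),\dots,\frac{\partial f_N}{\partial x_N}(\mathbf x))^T$; (3) $(a_{ij})$ is the weight matrix of an undirected connected graph on $\mathcal N$, that is, $a_{ij}=a_{ji}\ge 0$, $a_{ii}=0$, and the graph whose edges are the pairs with $a_{ij}>0$ is connected; (4) each $g_i:\mathbb R^N\to\mathbb R$ is twice continuously differentiable (so its first and second partial derivatives are bounded on bounded sets), and each $d_i$ is twice continuously differentiable on $[t_0,\infty)$ with $\dot d_i$ and $\ddot d_i$ bounded there. Fix $\bar\theta_{ij}>0$. For gains $\theta,k_i^s,c_i,\beta_i>0$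 consider the closed loop of the players' dynamics with $$u_i=-\tfrac{\partial f_i}{\partial x_i}(\mathbf y_i)-\hat z_i,\qquad \mathbf y_i=(y_{i1},\dots,y_{iN})^T,$$ $$\dot y_{ij}=-\theta\bar\theta_{ij}\Big(\sum_{k=1}^N a_{ik}(y_{ij}-y_{kj})+a_{ij}(y_{ij}-x_j)\Big),$$ $$\dot{\hat x}_i=u_i+\hat z_i+(k_i^s+c_i)(x_i-\hat x_i),\qquad \dot{\hat z}_i=k_i^sc_i(x_i-\hat x_i)+\beta_i\,\mathrm{sgn}(x_i-\hat x_i),$$ where solutions are understood in the sense of Filippov ($\hat z_i$ is locally absolutely continuous and satisfies its equation for almost every $t$ with some value in $[-1,1]$ in place of $\mathrm{sgn}(0)$). For a Nash equilibrium $\mathbf x^*$ (that is, $f_i(x_i^*,\mathbf x_{-i}^*)\le f_i(s,\mathbf x_{-i}^*)$ for all $i$ and $s\in\mathbb R$) put $\zeta_{i1}=x_i-\hat x_i$, $\zeta_{i2}=g_i(\mathbf x)+d_i(t)-\hat z_i$, $\xi_i=x_i-x_i^*$, $\eta_{ij}=y_{ij}-x_j$, $\gamma_i=\dot\zeta_{i1}+c_i\zeta_{i1}$,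 and let $\mathcal E_f=[\zeta_1^T,\zeta_2^T,\xi^T,\eta^T,\gamma^T]^T$ be the concatenated error vector, with the Euclidean norm. **Theorem.** The game has exactly one Nash equilibrium $\mathbf x^*$. Moreover, for every $v_1>0$ there is $\theta^*(v_1)>0$ such that for each $\theta>\theta^*$ there is $k_s^r(v_1,\theta)>0$ such that for all $k_i^s>k_s^r$ ($i\in\mathcal N$) there is $c^r(v_1,\theta,k_s)>0$ such that for all $c_i>c^r$ ($i\in\mathcal N$) there is $\beta^r(v_1,\theta,k_s,c)>0$ such that for all $\beta_i>\beta^r$ ($i\in\mathcal N$) the following holds for the solutions with $\|\mathcal E_f(t_0)\|\le v_1$: along every solution on a finite interval $[t_0,T)$, $\mathcal E_f$ stays bounded (no finite escape time), and along every solution on $[t_0,\infty)$, $$\|\mathcal E_f(t)\|\to 0\quad\text{as } t\to\infty .$$ In particular $\mathbf x(t)\to\mathbf x^*$ and $\hat z_i(t)-g_i(\mathbf x(t))-d_i(t)\to 0$ for all $i$. -/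

import Mathlib

namespace RISE

/-- `∂f_i/∂x_i` evaluated at `x`. -/
noncomputable def partialOwn {N : ℕ} (f : Fin N → (Fin N → ℝ) → ℝ) (i : Fin N)
    (x : Fin N → ℝ) : ℝ :=
  fderiv ℝ (f i) x (Pi.single i 1)

/-- The pseudo-gradient `Υ(x) = [∂f_i/∂x_i (x)]_vec`. -/
noncomputable def pseudoGradient {N : ℕ} (f : Fin N → (Fin N → ℝ) → ℝ)
    (x : Fin N → ℝ) : Fin N → ℝ :=
  fun i => partialOwn f i x

/-- `xs` is a Nash equilibrium: no player can lower its cost by changing its own action only. -/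
def IsNash {N : ℕ} (f : Fin N → (Fin N → ℝ) → ℝ) (xs : Fin N → ℝ) : Prop :=
  ∀ (i : Fin N) (s : ℝ), f i xs ≤ f i (Function.update xs i s)

/-- The graph on the players whose edges are the pairs with positive weight. -/
def commGraph {N : ℕ} (a : Matrix (Fin N) (Fin N) ℝ) : SimpleGraph (Fin N) :=
  SimpleGraph.fromRel fun i j => 0 < a i j

/-- `a` is the adjacency (weight) matrix of an undirected connected communication graph. -/
structure IsUndirectedConnected {N : ℕ} (a : Matrix (Fin N) (Fin N) ℝ) : Prop where
  nonneg : ∀ i j, 0 ≤ a i j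
  diag : ∀ i, a i i = 0
  symm : ∀ i j, a i j = a j i
  connected : (commGraph a).Connected

/-- The convexified signum: `{sgn r}` for `r ≠ 0`, and `[-1, 1]` for `r = 0`. -/
noncomputable def sgnSet (r : ℝ) : Set ℝ :=
  if r = 0 then Set.Icc (-1) 1 else {Real.sign r}

/-- The state of the closed loop: actions `x`, estimates `y i j` by player `i` of the action of
player `j`, and the observer states `xhat`, `zhat`, all as functions of time. -/
structure Trajectory (N : ℕ) where
  x : ℝ → Fin N → ℝ
  y : ℝ → Fin N → Fin N → ℝ
  xhat : ℝ → Fin N → ℝ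
  zhat : ℝ → Fin N → ℝ

namespace Trajectory

variable {N : ℕ} (S : Trajectory N)

/-- The control input `u_i = -∂f_i/∂x_i (y_i) - ẑ_i`. -/
noncomputable def u (f : Fin N → (Fin N → ℝ) → ℝ) (t : ℝ) (i : Fin N) : ℝ :=
  -partialOwn f i (S.y t i) - S.zhat t i

/-- `ζ_{i1} = x_i - x̂_i`. -/
def zeta1 (t : ℝ) (i : Fin N) : ℝ := S.x t i - S.xhat t i

/-- `ζ_{i2} = z_i - ẑ_i` with `z_i = g_i(x) + d_i(t)`. -/
def zeta2 (g : Fin N → (Fin N → ℝ) → ℝ) (d : Fin N → ℝ → ℝ) (t : ℝ) (i : Fin N) : ℝ :=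
  (g i (S.x t) + d i t) - S.zhat t i

/-- `ξ_i = x_i - x_i^*`. -/
def xi (xs : Fin N → ℝ) (t : ℝ) (i : Fin N) : ℝ := S.x t i - xs i

/-- `η_{ij} = y_{ij} - x_j`. -/
def eta (t : ℝ) (i j : Fin N) : ℝ := S.y t i j - S.x t j

/-- The filtered signal `γ_i = ζ̇_{i1} + c_i ζ_{i1}` of a trajectory on the time interval `J`
(the derivative is one-sided at an endpoint of `J`). -/
noncomputable def gamma (c : Fin N → ℝ) (J : Set ℝ) (t : ℝ) (i : Fin N) : ℝ :=
  derivWithin (fun τ => S.zeta1 τ i) J t + c i * S.zeta1 t i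

/-- The concatenated error vector `(ζ_1, ζ_2, ξ, η, γ)`; its norm is the Euclidean one. -/
noncomputable def error (g : Fin N → (Fin N → ℝ) → ℝ) (d : Fin N → ℝ → ℝ) (xs c : Fin N → ℝ)
    (J : Set ℝ) (t : ℝ) :
    EuclideanSpace ℝ (Fin N ⊕ Fin N ⊕ Fin N ⊕ (Fin N × Fin N) ⊕ Fin N) :=
  WithLp.toLp 2
    (Sum.elim (S.zeta1 t)
      (Sum.elim (S.zeta2 g d t)
        (Sum.elim (S.xi xs t)
          (Sum.elim (fun p => S.eta t p.1 p.2) (S.gamma c J t)))))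

/-- `S` is a (Filippov) solution of the closed loop on the interval `J` (which is
`[t₀, T)` or `[t₀, ∞)`).  The equations of `x`, `y`, `x̂` have continuous right-hand sides along a
solution and so hold at every time.  The equation of `ẑ` has the signum term: `ẑ_i` is locally
absolutely continuous and satisfies the equation almost everywhere, with a value in `[-1, 1]` for
`sgn 0`.  In particular every Carathéodory solution for the convention `sgn 0 = 0` is included. -/
structure IsSolution (f g : Fin N → (Fin N → ℝ) → ℝ) (d : Fin N → ℝ → ℝ)
    (a θbar : Matrix (Fin N) (Fin N) ℝ) (θ : ℝ) (ks c β : Fin N → ℝ)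
    (t₀ : ℝ) (J : Set ℝ) : Prop where
  deriv_x : ∀ t ∈ J, ∀ i,
    HasDerivWithinAt (fun τ => S.x τ i) (S.u f t i + g i (S.x t) + d i t) J t
  deriv_y : ∀ t ∈ J, ∀ i j,
    HasDerivWithinAt (fun τ => S.y τ i j)
      (-(θ * θbar i j) *
        (∑ k, a i k * (S.y t i j - S.y t k j) + a i j * (S.y t i j - S.x t j))) J t
  deriv_xhat : ∀ t ∈ J, ∀ i,
    HasDerivWithinAt (fun τ => S.xhat τ i)
      (S.u f t i + S.zhat t i + (ks i + c i) * (S.x t i - S.xhat t i)) J t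
  ac_zhat : ∀ t ∈ J, ∀ i, AbsolutelyContinuousOnInterval (fun τ => S.zhat τ i) t₀ t
  deriv_zhat : ∀ i, ∀ᵐ t, t ∈ J → ∃ s ∈ sgnSet (S.x t i - S.xhat t i),
    HasDerivWithinAt (fun τ => S.zhat τ i)
      (ks i * c i * (S.x t i - S.xhat t i) + β i * s) J t

end Trajectory

end RISE

namespace RISE

open Set Filter Topology MeasureTheory

/-! A Nash equilibrium is the same as a zero of the pseudo-gradient, and strong monotonicity gives
exactly one (`existsUnique_isNash`).

For convergence, everything is measured from the observer state: e = x̂ - x*, η = y - x̂, q = x - x̂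
and p = γ - (g(x) - g(x̂)). Since x̂' = -∂f(y) + (kˢ + c)q, the seeking subsystem (e, η) is forced
by q alone and never by p, which the energy controls only up to a factor √β. Strong monotonicity
damps e, the grounded graph Laplacian damps η, and a large θ beats their coupling
(`seeking_rate_le`). For the observer the energy is p²/(2β) + |q| - qḋ/β: in its derivative the
terms p·sgn q and pḋ/β cancel, leaving damping of order p²/β and c|q|, with errors that large c and
β make small (`observer_rate_le`).

Let V be the seeking energy plus A times the observer energy. On {V ≤ B} the forcing of the seeking
part is at most const·√B·∑ c|q|, so V' ≤ -κV as soon as A dominates const·√B (`lyapunov_rate_le`).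
The barrier B must exceed the initial value of V, whose bound is affine in A and, for β large, free
of the gains; as √ grows slower than linearly, a suitable A exists (`exists_gain`). Then V never
reaches B and decays exponentially (`exp_decay_of_barrier`), and V controls the error vector.

The choice of gains is not circular: A, B, the radius R of the working ball and the Lipschitz
constants L, G on it depend only on v₁ and the data; θ is chosen from L, then c from kˢ, θ, G, and β
last.

The discontinuity is harmless because |q| is absolutely continuous, and where q = 0 and |q| is
differentiable, q' = 0, so every selection of the signum gives the same derivative. -/

/-! ### Absolute continuity and the set-valued signum. -/

theorem absolutelyContinuous_abs {f : ℝ → ℝ} {a b : ℝ}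
    (hf : AbsolutelyContinuousOnInterval f a b) :
    AbsolutelyContinuousOnInterval (fun t => |f t|) a b := by
  refine squeeze_zero (fun t => ?_) (fun t => ?_) hf
  · exact Finset.sum_nonneg fun i _ => dist_nonneg
  · gcongr
    simp only [Real.dist_eq]
    exact abs_abs_sub_abs_le_abs_sub _ _

theorem absolutelyContinuous_sum {ι : Type*} (s : Finset ι) {f : ι → ℝ → ℝ} {a b : ℝ}
    (hf : ∀ i ∈ s, AbsolutelyContinuousOnInterval (f i) a b) :
    AbsolutelyContinuousOnInterval (fun t => ∑ i ∈ s, f i t) a b := by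
  classical
  induction s using Finset.induction_on with
  | empty =>
    simp only [Finset.sum_empty]
    exact (LipschitzWith.const (0 : ℝ)).lipschitzOnWith.absolutelyContinuousOnInterval
  | insert i s hi ih =>
    simp only [Finset.sum_insert hi]
    exact (hf i (by simp)).fun_add (ih fun j hj => hf j (by simp [hj]))

theorem absolutelyContinuous_of_hasDerivWithinAt {f f' : ℝ → ℝ} {a b : ℝ} (hab : a ≤ b)
    (hf : ∀ t ∈ Icc a b, HasDerivWithinAt f (f' t) (Icc a b) t)
    (hf' : ContinuousOn f' (Icc a b)) : AbsolutelyContinuousOnInterval f a b := by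
  obtain ⟨C, hC⟩ := isCompact_Icc.exists_bound_of_continuousOn hf'
  have h := (convex_Icc a b).lipschitzOnWith_of_nnnorm_hasDerivWithin_le
    (C := C.toNNReal) hf (fun t ht => by
      rw [← NNReal.coe_le_coe]
      exact (hC t ht).trans (Real.le_coe_toNNReal C))
  rw [← uIcc_of_le hab] at h
  exact h.absolutelyContinuousOnInterval

/-- At a zero of q, |q| has a minimum, so its derivative there vanishes and so does q'; the value of
s is then irrelevant. Elsewhere |q| is locally ±q. -/
theorem hasDerivAt_abs_of_mem_sgnSet {q : ℝ → ℝ} {q' s t : ℝ} (hq : HasDerivAt q q' t)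
    (hd : DifferentiableAt ℝ (fun τ => |q τ|) t) (hs : s ∈ sgnSet (q t)) :
    HasDerivAt (fun τ => |q τ|) (s * q') t := by
  by_cases h0 : q t = 0
  · have hmin : IsLocalMin (fun τ => |q τ|) t :=
      Eventually.of_forall fun τ => by simp [h0]
    have h1 : HasDerivAt (fun τ => |q τ|) 0 t := by
      have := hd.hasDerivAt
      rwa [hmin.hasDerivAt_eq_zero this] at this
    have h2 : HasDerivAt q 0 t := by
      rw [hasDerivAt_iff_isLittleO] at h1 ⊢
      rw [← Asymptotics.isLittleO_norm_left] at h1 ⊢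
      simpa [h0] using h1
    rw [hq.unique h2, mul_zero]
    exact h1
  · rw [sgnSet, if_neg h0, mem_singleton_iff] at hs
    subst hs
    rcases lt_or_gt_of_ne h0 with h | h
    · rw [Real.sign_of_neg h]
      have : (fun τ => |q τ|) =ᶠ[𝓝 t] fun τ => -q τ := by
        filter_upwards [hq.continuousAt.eventually_lt_const h] with τ hτ
        exact abs_of_neg hτ
      rw [this.hasDerivAt_iff]
      simpa using hq.fun_neg
    · rw [Real.sign_of_pos h]
      have : (fun τ => |q τ|) =ᶠ[𝓝 t] fun τ => q τ := by
        filter_upwards [hq.continuousAt.eventually_const_lt h] with τ hτ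
        exact abs_of_pos hτ
      rw [this.hasDerivAt_iff]
      simpa using hq

theorem mul_self_eq_abs_of_mem_sgnSet {r s : ℝ} (hs : s ∈ sgnSet r) : s * r = |r| := by
  by_cases h0 : r = 0
  · simp [h0]
  · rw [sgnSet, if_neg h0, mem_singleton_iff] at hs
    subst hs
    rcases lt_or_gt_of_ne h0 with h | h
    · rw [Real.sign_of_neg h, abs_of_neg h]; ring
    · rw [Real.sign_of_pos h, abs_of_pos h]; ring

theorem abs_le_one_of_mem_sgnSet {r s : ℝ} (hs : s ∈ sgnSet r) : |s| ≤ 1 := by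
  by_cases h0 : r = 0
  · rw [sgnSet, if_pos h0] at hs
    exact abs_le.2 hs
  · rw [sgnSet, if_neg h0, mem_singleton_iff] at hs
    subst hs
    rcases lt_or_gt_of_ne h0 with h | h
    · simp [Real.sign_of_neg h]
    · simp [Real.sign_of_pos h]

/-! ### Differential inequalities that hold almost everywhere. -/

theorem le_of_ae_hasDerivAt_nonpos {V : ℝ → ℝ} {a b : ℝ} (hab : a ≤ b)
    (hV : AbsolutelyContinuousOnInterval V a b)
    (hd : ∀ᵐ t, t ∈ Ioo a b → ∃ D, D ≤ 0 ∧ HasDerivAt V D t) : V b ≤ V a := by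
  have h := hV.integral_deriv_eq_sub
  have h2 : ∫ t in a..b, deriv V t ≤ 0 := by
    rw [intervalIntegral.integral_of_le hab, integral_Ioc_eq_integral_Ioo]
    refine integral_nonpos_of_ae ?_
    refine (ae_restrict_iff' measurableSet_Ioo).2 ?_
    filter_upwards [hd] with t ht hmem
    obtain ⟨D, hD, hVD⟩ := ht hmem
    rw [hVD.deriv]
    exact hD
  linarith

/-- A nonnegative absolutely continuous function that decays exponentially as long as it stays
below a barrier, and starts below it, decays exponentially. -/
theorem exp_decay_of_barrier {U : ℝ → ℝ} {a b κ B : ℝ} (hab : a ≤ b) (hκ : 0 ≤ κ)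
    (hU : AbsolutelyContinuousOnInterval U a b) (h0 : 0 ≤ U a) (hB : U a < B)
    (hd : ∀ᵐ t, t ∈ Ioo a b → U t ≤ B → ∃ D, D ≤ -κ * U t ∧ HasDerivAt U D t) :
    U b ≤ U a * Real.exp (-κ * (b - a)) := by
  -- Integrating factor: exp(κ(t - a)) U is nonincreasing as long as the barrier is respected.
  have key : ∀ s ∈ Icc a b, (∀ t ∈ Ioo a s, U t ≤ B) → U s ≤ U a * Real.exp (-κ * (s - a)) := by
    intro s hs hle
    have hE : ∀ t, HasDerivAt (fun t => Real.exp (κ * (t - a))) (Real.exp (κ * (t - a)) * κ) t := by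
      intro t
      have := (((hasDerivAt_id t).sub_const a).const_mul κ).exp
      simpa using this
    have hEac : AbsolutelyContinuousOnInterval (fun t => Real.exp (κ * (t - a))) a s :=
      ContDiffOn.absolutelyContinuousOnInterval (by fun_prop)
    have hUs : AbsolutelyContinuousOnInterval U a s :=
      hU.mono (by rw [uIcc_of_le hab, uIcc_of_le hs.1]; exact Icc_subset_Icc_right hs.2)
    have hV := le_of_ae_hasDerivAt_nonpos hs.1 (hEac.fun_mul hUs) (by
      filter_upwards [hd] with t ht hmem
      obtain ⟨D, hD, hUD⟩ := ht ⟨hmem.1, hmem.2.trans_le hs.2⟩ (hle t hmem)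
      refine ⟨_, ?_, (hE t).mul hUD⟩
      have : 0 < Real.exp (κ * (t - a)) := Real.exp_pos _
      nlinarith)
    simp only [sub_self, mul_zero, Real.exp_zero, one_mul] at hV
    calc U s = Real.exp (-κ * (s - a)) * (Real.exp (κ * (s - a)) * U s) := by
          rw [← mul_assoc, ← Real.exp_add]; simp
      _ ≤ Real.exp (-κ * (s - a)) * U a := by gcongr
      _ = _ := mul_comm _ _
  -- At a first time τ with U τ ≥ B, `key` applies on [a, τ] and gives U τ ≤ U a < B.
  have hlt : ∀ t ∈ Icc a b, U t < B := by
    by_contra! hcon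
    have hc : ContinuousOn U (Icc a b) := by simpa [uIcc_of_le hab] using hU.continuousOn
    have hK : IsCompact (Icc a b ∩ U ⁻¹' Ici B) :=
      isCompact_Icc.of_isClosed_subset
        (hc.preimage_isClosed_of_isClosed isClosed_Icc isClosed_Ici) inter_subset_left
    obtain ⟨t, ht, htB⟩ := hcon
    obtain ⟨τ, hτ, hmin⟩ := hK.exists_isLeast ⟨t, ht, htB⟩
    have h1 := key τ hτ.1 (fun t ht => by
      by_contra! hh
      have := hmin ⟨⟨ht.1.le, ht.2.le.trans hτ.1.2⟩, hh.le⟩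
      exact absurd ht.2 (not_lt.2 this))
    have h2 : Real.exp (-κ * (τ - a)) ≤ 1 := by
      rw [Real.exp_le_one_iff]
      nlinarith [hτ.1.1]
    have h3 : B ≤ U τ := hτ.2
    nlinarith
  exact key b ⟨hab, le_rfl⟩ fun t ht => (hlt t ⟨ht.1.le, ht.2.le⟩).le

/-! ### Coercivity of the grounded graph Laplacian. -/

section

/-- A continuous function on `ℝ^N`, homogeneous of degree two and positive off the origin,
dominates a multiple of the sup norm squared. -/
theorem exists_coercive {ι : Type*} [Fintype ι] {Q : (ι → ℝ) → ℝ} (hc : Continuous Q)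
    (hh : ∀ (r : ℝ) v, Q (r • v) = r ^ 2 * Q v) (hp : ∀ v, v ≠ 0 → 0 < Q v) :
    ∃ l : ℝ, 0 < l ∧ ∀ v, l * ‖v‖ ^ 2 ≤ Q v := by
  have hQ0 : Q 0 = 0 := by
    have h := hh 0 0
    rw [smul_zero] at h
    linarith
  by_cases hne : (Metric.sphere (0 : ι → ℝ) 1).Nonempty
  · obtain ⟨u, hu, hmin⟩ := (isCompact_sphere (0 : ι → ℝ) 1).exists_isMinOn hne hc.continuousOn
    have hu1 : ‖u‖ = 1 := by simpa using hu
    refine ⟨Q u, hp u (by intro h; simp [h] at hu1), fun v => ?_⟩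
    rcases eq_or_ne v 0 with rfl | hv
    · simp [hQ0]
    · have hv' : 0 < ‖v‖ := norm_pos_iff.2 hv
      have h1 : Q u ≤ Q (‖v‖⁻¹ • v) :=
        hmin (by simp [norm_smul, hv'.ne'])
      rw [hh, inv_pow] at h1
      have h2 : Q u * ‖v‖ ^ 2 ≤ (‖v‖ ^ 2)⁻¹ * Q v * ‖v‖ ^ 2 := by gcongr
      calc Q u * ‖v‖ ^ 2 ≤ _ := h2
        _ = Q v := by field_simp
  · refine ⟨1, one_pos, fun v => ?_⟩
    rcases eq_or_ne v 0 with rfl | hv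
    · simp [hQ0]
    · have hv' : 0 < ‖v‖ := norm_pos_iff.2 hv
      exact absurd ⟨‖v‖⁻¹ • v, by simp [norm_smul, hv'.ne']⟩ hne

variable {N : ℕ} {a : Matrix (Fin N) (Fin N) ℝ}

theorem sum_mul_laplacian_eq (hs : ∀ i j, a i j = a j i) (v : Fin N → ℝ) :
    ∑ i, v i * ∑ k, a i k * (v i - v k) = (1 / 2) * ∑ i, ∑ k, a i k * (v i - v k) ^ 2 := by
  have h1 : ∑ i, v i * ∑ k, a i k * (v i - v k) = ∑ i, ∑ k, a i k * (v i * (v i - v k)) := by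
    simp only [Finset.mul_sum]
    exact Finset.sum_congr rfl fun i _ => Finset.sum_congr rfl fun k _ => by ring
  have h2 : ∑ i, ∑ k, a i k * (v i * (v i - v k)) = ∑ i, ∑ k, a i k * (v k * (v k - v i)) := by
    rw [Finset.sum_comm]
    exact Finset.sum_congr rfl fun i _ => Finset.sum_congr rfl fun k _ => by rw [hs]
  have h3 : ∑ i, ∑ k, a i k * (v i - v k) ^ 2
      = ∑ i, ∑ k, a i k * (v i * (v i - v k)) + ∑ i, ∑ k, a i k * (v k * (v k - v i)) := by
    simp only [← Finset.sum_add_distrib]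
    exact Finset.sum_congr rfl fun i _ => Finset.sum_congr rfl fun k _ => by ring
  rw [h1, h3, ← h2]; ring

/-- The form is half the Dirichlet energy plus ∑ a_ij v_i². If it vanishes, v is constant along
edges, hence constant by connectedness, and zero at some neighbour of j. Such a neighbour exists
because there are at least two players. -/
theorem IsUndirectedConnected.pos_of_ne_zero (ha : IsUndirectedConnected a) (hN : 2 ≤ N)
    (j : Fin N) {v : Fin N → ℝ} (hv : v ≠ 0) :
    0 < ∑ i, v i * (∑ k, a i k * (v i - v k) + a i j * v i) := by
  have hsplit : ∑ i, v i * (∑ k, a i k * (v i - v k) + a i j * v i)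
      = (1 / 2) * ∑ i, ∑ k, a i k * (v i - v k) ^ 2 + ∑ i, a i j * v i ^ 2 := by
    rw [← sum_mul_laplacian_eq ha.symm, ← Finset.sum_add_distrib]
    exact Finset.sum_congr rfl fun i _ => by ring
  have n1 : ∀ i k, 0 ≤ a i k * (v i - v k) ^ 2 := fun i k => mul_nonneg (ha.nonneg i k) (sq_nonneg _)
  have n2 : ∀ i, 0 ≤ a i j * v i ^ 2 := fun i => mul_nonneg (ha.nonneg i j) (sq_nonneg _)
  have n3 : ∀ i, 0 ≤ ∑ k, a i k * (v i - v k) ^ 2 := fun i => Finset.sum_nonneg fun k _ => n1 i k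
  have N1 : 0 ≤ ∑ i, ∑ k, a i k * (v i - v k) ^ 2 := Finset.sum_nonneg fun i _ => n3 i
  have N2 : 0 ≤ ∑ i, a i j * v i ^ 2 := Finset.sum_nonneg fun i _ => n2 i
  rw [hsplit]
  by_contra! hle
  have z1 : ∑ i, ∑ k, a i k * (v i - v k) ^ 2 = 0 := by linarith
  have z2 : ∑ i, a i j * v i ^ 2 = 0 := by linarith
  have e1 : ∀ i k, a i k * (v i - v k) ^ 2 = 0 := fun i k =>
    (Finset.sum_eq_zero_iff_of_nonneg fun k _ => n1 i k).1
      ((Finset.sum_eq_zero_iff_of_nonneg fun i _ => n3 i).1 z1 i (Finset.mem_univ i)) k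
      (Finset.mem_univ k)
  have e2 : ∀ i, a i j * v i ^ 2 = 0 := fun i =>
    (Finset.sum_eq_zero_iff_of_nonneg fun i _ => n2 i).1 z2 i (Finset.mem_univ i)
  have hadj : ∀ i k, (commGraph a).Adj i k → 0 < a i k := by
    intro i k h
    rw [commGraph, SimpleGraph.fromRel_adj] at h
    rcases h.2 with h | h
    · exact h
    · rwa [ha.symm]
  have hedge : ∀ i k, (commGraph a).Adj i k → v i = v k := by
    intro i k h
    have := (mul_eq_zero.1 (e1 i k)).resolve_left (hadj i k h).ne'
    exact sub_eq_zero.1 (pow_eq_zero_iff two_ne_zero |>.1 this)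
  have hconst : ∀ i k, v i = v k := by
    intro i k
    obtain ⟨w⟩ := ha.connected.preconnected i k
    induction w with
    | nil => rfl
    | cons h _ ih => exact (hedge _ _ h).trans ih
  have : Nontrivial (Fin N) := Fin.nontrivial_iff_two_le.2 hN
  obtain ⟨i, hi⟩ := ha.connected.preconnected.exists_adj_of_nontrivial j
  have hvi : v i = 0 := by
    have := (mul_eq_zero.1 (e2 i)).resolve_left (hadj i j hi.symm).ne'
    exact pow_eq_zero_iff two_ne_zero |>.1 this
  exact hv (funext fun k => (hconst k i).trans hvi)

theorem IsUndirectedConnected.exists_coercive (ha : IsUndirectedConnected a) (hN : 2 ≤ N) :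
    ∃ l : ℝ, 0 < l ∧ ∀ (j : Fin N) (v : Fin N → ℝ),
      l * ‖v‖ ^ 2 ≤ ∑ i, v i * (∑ k, a i k * (v i - v k) + a i j * v i) := by
  have h : ∀ j : Fin N, ∃ l : ℝ, 0 < l ∧ ∀ v : Fin N → ℝ,
      l * ‖v‖ ^ 2 ≤ ∑ i, v i * (∑ k, a i k * (v i - v k) + a i j * v i) := by
    intro j
    refine RISE.exists_coercive (by fun_prop) (fun r v => ?_) fun v hv => ha.pos_of_ne_zero hN j hv
    rw [Finset.mul_sum]
    refine Finset.sum_congr rfl fun i _ => ?_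
    simp only [Pi.smul_apply, smul_eq_mul]
    have : ∑ k, a i k * (r * v i - r * v k) = r * ∑ k, a i k * (v i - v k) := by
      rw [Finset.mul_sum]
      exact Finset.sum_congr rfl fun k _ => by ring
    rw [this]; ring
  choose l hl hle using h
  have : Nonempty (Fin N) := ⟨⟨0, by omega⟩⟩
  obtain ⟨j₀, hj₀⟩ := Finite.exists_min l
  exact ⟨l j₀, hl j₀, fun j v => le_trans (by gcongr; exact hj₀ j) (hle j v)⟩

end

/-! ### Existence and uniqueness of the Nash equilibrium. -/

section

variable {N : ℕ} {f : Fin N → (Fin N → ℝ) → ℝ}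

theorem contDiff_partialOwn {i : Fin N} (hf : ContDiff ℝ 2 (f i)) :
    ContDiff ℝ 1 (partialOwn f i) := by
  unfold partialOwn
  exact (hf.fderiv_right (m := 1) (by norm_num)).clm_apply contDiff_const

theorem contDiff_pseudoGradient (hf : ∀ i, ContDiff ℝ 2 (f i)) :
    ContDiff ℝ 1 (pseudoGradient f) :=
  contDiff_pi.2 fun i => contDiff_partialOwn (hf i)

theorem hasDerivAt_comp_update {i : Fin N} (hf : ContDiff ℝ 2 (f i)) (x : Fin N → ℝ) (s : ℝ) :
    HasDerivAt (fun s => f i (Function.update x i s))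
      (partialOwn f i (Function.update x i s)) s := by
  have h1 := ((hf.differentiable (by norm_num)) (Function.update x i s)).hasFDerivAt
  have h2 := h1.comp_hasDerivAt s (hasDerivAt_update x i s)
  exact h2

theorem IsNash.pseudoGradient_eq_zero (hf : ∀ i, ContDiff ℝ 2 (f i)) {xs : Fin N → ℝ}
    (h : IsNash f xs) : pseudoGradient f xs = 0 := by
  funext i
  have hmin : IsLocalMin (fun s => f i (Function.update xs i s)) (xs i) :=
    Eventually.of_forall fun s => by simpa using h i s
  have := hmin.hasDerivAt_eq_zero (hasDerivAt_comp_update (hf i) xs (xs i))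
  simpa [pseudoGradient] using this

/-- Monotonicity along a single coordinate gives the own partial derivative at r the sign of r -
x_i^*, so the mean value theorem makes x_i^* a global minimizer of player i's cost in its own
action. -/
theorem isNash_of_pseudoGradient_eq_zero (hf : ∀ i, ContDiff ℝ 2 (f i)) {m : ℝ} (hm : 0 < m)
    (hmono : ∀ x z : Fin N → ℝ, m * ((x - z) ⬝ᵥ (x - z)) ≤
        (x - z) ⬝ᵥ (pseudoGradient f x - pseudoGradient f z))
    {xs : Fin N → ℝ} (h : pseudoGradient f xs = 0) : IsNash f xs := by
  intro i s
  have hsgn : ∀ r, 0 ≤ (r - xs i) * partialOwn f i (Function.update xs i r) := by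
    intro r
    have h1 := hmono (Function.update xs i r) xs
    have h2 : Function.update xs i r - xs = Pi.single i (r - xs i) := by
      funext k
      rcases eq_or_ne k i with rfl | hk
      · simp
      · simp [hk]
    rw [h2, h, sub_zero, single_dotProduct, single_dotProduct] at h1
    refine le_trans ?_ h1
    simp only [Pi.single_eq_same]
    nlinarith [mul_self_nonneg (r - xs i)]
  have hd := hasDerivAt_comp_update (hf i) xs
  have hc : Continuous fun s => f i (Function.update xs i s) :=
    continuous_iff_continuousAt.2 fun s => (hd s).continuousAt
  rcases lt_trichotomy (xs i) s with hs | hs | hs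
  · obtain ⟨r, hr, he⟩ := exists_hasDerivAt_eq_slope _ _ hs hc.continuousOn fun r _ => hd r
    have h1 := hsgn r
    have h2 : 0 ≤ partialOwn f i (Function.update xs i r) :=
      nonneg_of_mul_nonneg_right h1 (sub_pos.2 hr.1)
    rw [he, le_div_iff₀ (sub_pos.2 hs)] at h2
    simpa using h2
  · subst hs; simp
  · obtain ⟨r, hr, he⟩ := exists_hasDerivAt_eq_slope _ _ hs hc.continuousOn fun r _ => hd r
    have h1 := hsgn r
    have h2 : partialOwn f i (Function.update xs i r) ≤ 0 := by
      have := sub_neg.2 hr.2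
      by_contra! h3
      nlinarith
    rw [he, div_le_iff₀ (sub_pos.2 hs)] at h2
    simpa using h2

/-- A strongly monotone continuously differentiable map has a zero: the squared norm of its value
attains a minimum, and its derivative at a minimizer forces the value to vanish. -/
theorem exists_zero_of_strongly_monotone {F : (Fin N → ℝ) → Fin N → ℝ} (hF : ContDiff ℝ 1 F)
    {m : ℝ} (hm : 0 < m)
    (hmono : ∀ x z : Fin N → ℝ, m * ((x - z) ⬝ᵥ (x - z)) ≤ (x - z) ⬝ᵥ (F x - F z)) :
    ∃ x, F x = 0 := by
  have hFc := hF.continuous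
  have hcoer : ∀ x, m * ‖x‖ ≤ N * (‖F x‖ + ‖F 0‖) := by
    intro x
    rcases eq_or_ne x 0 with rfl | hx
    · simp only [norm_zero, mul_zero]; positivity
    · have h1 := hmono x 0
      simp only [sub_zero] at h1
      have h2 : ‖x‖ ^ 2 ≤ x ⬝ᵥ x := by
        have : Nonempty (Fin N) := by
          by_contra hne
          exact hx (funext fun i => absurd ⟨i⟩ hne)
        obtain ⟨i, hi⟩ := Finite.exists_max fun i => ‖x i‖
        have h3 : ‖x‖ ≤ ‖x i‖ := (pi_norm_le_iff_of_nonneg (norm_nonneg _)).2 hi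
        calc ‖x‖ ^ 2 ≤ ‖x i‖ ^ 2 := by gcongr
          _ = x i * x i := by rw [Real.norm_eq_abs, sq_abs, sq]
          _ ≤ x ⬝ᵥ x := Finset.single_le_sum (f := fun i => x i * x i)
              (fun i _ => mul_self_nonneg _) (Finset.mem_univ i)
      have h4 : x ⬝ᵥ (F x - F 0) ≤ N * (‖x‖ * (‖F x‖ + ‖F 0‖)) := by
        calc x ⬝ᵥ (F x - F 0) ≤ ∑ _i : Fin N, ‖x‖ * (‖F x‖ + ‖F 0‖) := by
              refine Finset.sum_le_sum fun i _ => ?_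
              refine (le_abs_self _).trans ?_
              rw [abs_mul]
              gcongr
              · exact norm_le_pi_norm x i
              · exact (norm_le_pi_norm (F x - F 0) i).trans (norm_sub_le _ _)
          _ = _ := by simp
      have hx' : 0 < ‖x‖ := norm_pos_iff.2 hx
      have h5 : (m * ‖x‖) * ‖x‖ ≤ (N * (‖F x‖ + ‖F 0‖)) * ‖x‖ := by nlinarith
      exact le_of_mul_le_mul_right h5 hx'
  have htend : Tendsto (fun x => F x ⬝ᵥ F x) (cocompact (Fin N → ℝ)) atTop := by
    have hn : Tendsto (fun x : Fin N → ℝ => ‖F x‖) (cocompact (Fin N → ℝ)) atTop := by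
      rcases Nat.eq_zero_or_pos N with hN0 | hN0
      · subst hN0
        rw [cocompact_eq_bot]
        exact tendsto_bot
      have h1 : Tendsto (fun x : Fin N → ℝ => m / N * ‖x‖ + -‖F 0‖) (cocompact (Fin N → ℝ)) atTop :=
        tendsto_atTop_add_const_right _ _
          ((tendsto_norm_cocompact_atTop).const_mul_atTop (by positivity))
      refine tendsto_atTop_mono (fun x => ?_) h1
      have hN' : (0 : ℝ) < N := by exact_mod_cast hN0
      have h2 := hcoer x
      rw [div_mul_eq_mul_div, ← sub_eq_add_neg, sub_le_iff_le_add, div_le_iff₀ hN']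
      linarith
    have hsq : Tendsto (fun x : Fin N → ℝ => ‖F x‖ ^ 2) (cocompact (Fin N → ℝ)) atTop :=
      (tendsto_pow_atTop two_ne_zero).comp hn
    refine tendsto_atTop_mono (fun x => ?_) hsq
    have h0 : ‖F x‖ ≤ √(F x ⬝ᵥ F x) := by
      refine (pi_norm_le_iff_of_nonneg (Real.sqrt_nonneg _)).2 fun i => ?_
      refine Real.le_sqrt_of_sq_le ?_
      rw [Real.norm_eq_abs, sq_abs, sq]
      exact Finset.single_le_sum (f := fun i => F x i * F x i)
              (fun i _ => mul_self_nonneg _) (Finset.mem_univ i)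
    calc ‖F x‖ ^ 2 ≤ √(F x ⬝ᵥ F x) ^ 2 := by gcongr
      _ = F x ⬝ᵥ F x := Real.sq_sqrt (Finset.sum_nonneg fun i _ => mul_self_nonneg _)
  have hcont : Continuous fun x => F x ⬝ᵥ F x := by
    have : ∀ i, Continuous fun x => F x i := fun i => (continuous_apply i).comp hFc
    unfold dotProduct
    fun_prop
  obtain ⟨x, hx⟩ := hcont.exists_forall_le htend
  refine ⟨x, ?_⟩
  set w := F x with hw
  have hline : HasDerivAt (fun s : ℝ => x + s • w) w 0 := by
    simpa using ((hasDerivAt_id (0 : ℝ)).smul_const w).const_add x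
  have hFx : HasFDerivAt F (fderiv ℝ F x) (x + (0 : ℝ) • w) := by
    simpa using (hF.differentiable one_ne_zero x).hasFDerivAt
  have hder : HasDerivAt (fun s : ℝ => F (x + s • w)) (fderiv ℝ F x w) 0 :=
    hFx.comp_hasDerivAt (0 : ℝ) hline
  set v := fderiv ℝ F x w with hv
  have hderi : ∀ i, HasDerivAt (fun s : ℝ => F (x + s • w) i) (v i) 0 := hasDerivAt_pi.1 hder
  have hsq : HasDerivAt (fun s : ℝ => F (x + s • w) ⬝ᵥ F (x + s • w))
      (∑ i, (v i * w i + w i * v i)) 0 := by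
    have := HasDerivAt.fun_sum (u := Finset.univ) fun i _ => (hderi i).mul (hderi i)
    simpa [dotProduct, hw] using this
  have hmin : IsLocalMin (fun s : ℝ => F (x + s • w) ⬝ᵥ F (x + s • w)) 0 :=
    Eventually.of_forall fun s => by simpa using hx (x + s • w)
  have hz := hmin.hasDerivAt_eq_zero hsq
  have hz' : w ⬝ᵥ v = 0 := by
    have : ∑ i, (v i * w i + w i * v i) = 2 * (w ⬝ᵥ v) := by
      rw [dotProduct, Finset.mul_sum]
      exact Finset.sum_congr rfl fun i _ => by ring
    linarith
  have hlin : HasDerivAt (fun s : ℝ => w ⬝ᵥ F (x + s • w)) (w ⬝ᵥ v) 0 := by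
    have := HasDerivAt.fun_sum (u := Finset.univ) fun i _ => (hderi i).const_mul (w i)
    simpa [dotProduct] using this
  have hslope := hasDerivAt_iff_tendsto_slope_zero.1 hlin
  -- Strong monotonicity between x + s w and x bounds the difference quotient from below; let s
  -- decrease to 0. Minimality gave w·v = 0, so w = 0.
  have hge : m * (w ⬝ᵥ w) ≤ w ⬝ᵥ v := by
    refine ge_of_tendsto (hslope.mono_left (nhdsGT_le_nhdsNE 0)) ?_
    filter_upwards [self_mem_nhdsWithin] with s hs
    have hs0 : (0 : ℝ) < s := hs
    have h1 := hmono (x + s • w) x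
    simp only [add_sub_cancel_left, smul_dotProduct, dotProduct_smul, smul_eq_mul,
      dotProduct_sub] at h1
    simp only [zero_add, zero_smul, add_zero, smul_eq_mul]
    rw [inv_mul_eq_div, le_div_iff₀ hs0]
    have h2 : s * (m * (w ⬝ᵥ w) * s) ≤ s * (w ⬝ᵥ F (x + s • w) - w ⬝ᵥ F x) := by
      calc _ = m * (s * (s * (w ⬝ᵥ w))) := by ring
        _ ≤ _ := h1
        _ = _ := by ring
    exact le_of_mul_le_mul_left h2 hs0
  have h0 : w ⬝ᵥ w = 0 := by
    have h1 : 0 ≤ w ⬝ᵥ w := Finset.sum_nonneg fun i _ => mul_self_nonneg _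
    rw [hz'] at hge
    nlinarith
  exact dotProduct_self_eq_zero.1 h0

theorem existsUnique_isNash (hf : ∀ i, ContDiff ℝ 2 (f i)) {m : ℝ} (hm : 0 < m)
    (hmono : ∀ x z : Fin N → ℝ, m * ((x - z) ⬝ᵥ (x - z)) ≤
        (x - z) ⬝ᵥ (pseudoGradient f x - pseudoGradient f z)) :
    ∃! xs, IsNash f xs := by
  obtain ⟨xs, hxs⟩ := exists_zero_of_strongly_monotone (contDiff_pseudoGradient hf) hm hmono
  refine ⟨xs, isNash_of_pseudoGradient_eq_zero hf hm hmono hxs, fun z hz => ?_⟩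
  have h := hmono z xs
  rw [hxs, hz.pseudoGradient_eq_zero hf, sub_zero, dotProduct_zero] at h
  have h1 : 0 ≤ (z - xs) ⬝ᵥ (z - xs) := Finset.sum_nonneg fun i _ => mul_self_nonneg _
  have h0 : (z - xs) ⬝ᵥ (z - xs) = 0 := by nlinarith
  exact sub_eq_zero.1 (dotProduct_self_eq_zero.1 h0)

end

/-! ### The Lyapunov function and the rates of its two parts. -/

section

theorem sq_norm_le_sum {ι : Type*} [Fintype ι] (v : ι → ℝ) : ‖v‖ ^ 2 ≤ ∑ i, v i ^ 2 := by
  have hs : 0 ≤ ∑ i, v i ^ 2 := Finset.sum_nonneg fun i _ => sq_nonneg _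
  refine (Real.le_sqrt (norm_nonneg _) hs).1 ?_
  refine (pi_norm_le_iff_of_nonneg (Real.sqrt_nonneg _)).2 fun i => ?_
  refine Real.le_sqrt_of_sq_le ?_
  rw [Real.norm_eq_abs, sq_abs]
  exact Finset.single_le_sum (f := fun i => v i ^ 2) (fun i _ => sq_nonneg _) (Finset.mem_univ i)

theorem abs_le_pi_norm {ι : Type*} [Fintype ι] (v : ι → ℝ) (i : ι) : |v i| ≤ ‖v‖ :=
  norm_le_pi_norm v i

theorem abs_le_pi_norm₂ {ι κ : Type*} [Fintype ι] [Fintype κ] (v : ι → κ → ℝ) (i : ι) (j : κ) :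
    |v i j| ≤ ‖v‖ :=
  (norm_le_pi_norm (v i) j).trans (norm_le_pi_norm v i)

theorem sq_norm_le_sum₂ {ι κ : Type*} [Fintype ι] [Fintype κ] (v : ι → κ → ℝ) :
    ‖v‖ ^ 2 ≤ ∑ i, ∑ j, v i j ^ 2 := by
  have hs : 0 ≤ ∑ i, ∑ j, v i j ^ 2 :=
    Finset.sum_nonneg fun i _ => Finset.sum_nonneg fun j _ => sq_nonneg _
  refine (Real.le_sqrt (norm_nonneg _) hs).1 ?_
  refine (pi_norm_le_iff_of_nonneg (Real.sqrt_nonneg _)).2 fun i => ?_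
  refine Real.le_sqrt_of_sq_le ((sq_norm_le_sum (v i)).trans ?_)
  exact Finset.single_le_sum (f := fun i => ∑ j, v i j ^ 2)
    (fun i _ => Finset.sum_nonneg fun j _ => sq_nonneg _) (Finset.mem_univ i)

/-- The Lyapunov function, in the coordinates `e = x̂ - x*`, `η_{ij} = y_{ij} - x̂_j`, `q = x - x̂`
and `p = γ - (g(x) - g(x̂))`; the vector `d₁` is the time derivative of the disturbance. -/
noncomputable def lyapunov {N : ℕ} (θbar : Matrix (Fin N) (Fin N) ℝ) (A : ℝ)
    (β e q p d₁ : Fin N → ℝ) (η : Fin N → Fin N → ℝ) : ℝ :=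
  ∑ i, e i ^ 2 / 2 + ∑ i, ∑ j, η i j ^ 2 / (2 * θbar i j) +
    A * ∑ i, (p i ^ 2 / (2 * β i) + |q i| - q i * d₁ i / β i)

/-- The time derivative of `lyapunov` when its arguments have the derivatives `e'`, `q'`, `p'`,
`d₂`, `η'` and `s` is a selection of the signum of `q`. -/
noncomputable def lyapunovRate {N : ℕ} (θbar : Matrix (Fin N) (Fin N) ℝ) (A : ℝ)
    (β s e q p d₁ : Fin N → ℝ) (η : Fin N → Fin N → ℝ) (e' q' p' d₂ : Fin N → ℝ)
    (η' : Fin N → Fin N → ℝ) : ℝ :=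
  ∑ i, e i * e' i + ∑ i, ∑ j, η i j * η' i j / θbar i j +
    A * ∑ i, (p i * p' i / β i + s i * q' i - (q' i * d₁ i + q i * d₂ i) / β i)

variable {N : ℕ} {a θbar : Matrix (Fin N) (Fin N) ℝ} {e q w p d₁ d₂ s h r ks c β : Fin N → ℝ}
  {η : Fin N → Fin N → ℝ} {m L l b ab θ : ℝ}

/-- Each column of η contributes a nonnegative term, so it is enough to keep the column containing
the largest entry. -/
theorem consensus_form_ge
    (hl : ∀ (j : Fin N) (v : Fin N → ℝ),
      l * ‖v‖ ^ 2 ≤ ∑ i, v i * (∑ k, a i k * (v i - v k) + a i j * v i)) (hl0 : 0 ≤ l)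
    (η : Fin N → Fin N → ℝ) :
    l * ‖η‖ ^ 2 ≤ ∑ i, ∑ j, η i j * (∑ k, a i k * (η i j - η k j) + a i j * η i j) := by
  rw [Finset.sum_comm]
  rcases isEmpty_or_nonempty (Fin N) with hN | hN
  · have : η = 0 := Subsingleton.elim _ _
    simp [this]
  obtain ⟨i₀, hi₀⟩ := Finite.exists_max fun i => ‖η i‖
  obtain ⟨j₀, hj₀⟩ := Finite.exists_max fun j => ‖η i₀ j‖
  have h1 : ‖η‖ ≤ ‖η i₀ j₀‖ :=
    ((pi_norm_le_iff_of_nonneg (norm_nonneg _)).2 hi₀).trans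
      ((pi_norm_le_iff_of_nonneg (norm_nonneg _)).2 hj₀)
  have h2 : ‖η‖ ≤ ‖fun i => η i j₀‖ := h1.trans (norm_le_pi_norm (fun i => η i j₀) i₀)
  calc l * ‖η‖ ^ 2 ≤ l * ‖fun i => η i j₀‖ ^ 2 := by gcongr
    _ ≤ _ := hl j₀ _
    _ ≤ _ := Finset.single_le_sum
      (f := fun j => ∑ i, η i j * (∑ k, a i k * (η i j - η k j) + a i j * η i j))
      (fun j _ => le_trans (by positivity) (hl j fun i => η i j)) (Finset.mem_univ j₀)

/-- Here w stands for the partial derivatives at the estimates. Every occurrence of q is charged to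
∑ c|q|, the quantity that the observer part dissipates; this is why c must dominate both kˢ and θ.
-/
theorem seeking_rate_le (hN : 0 < N) (hθbar : ∀ i j, 0 < θbar i j) (hb : ∀ i j, (θbar i j)⁻¹ ≤ b)
    (ha : ∀ i j, 0 ≤ a i j) (hab : ∀ i j, a i j ≤ ab)
    (hl : ∀ (j : Fin N) (v : Fin N → ℝ),
      l * ‖v‖ ^ 2 ≤ ∑ i, v i * (∑ k, a i k * (v i - v k) + a i j * v i)) (hl0 : 0 ≤ l)
    (hθ : 0 ≤ θ)
    (hew : m * ‖e‖ ^ 2 - N * L * ‖e‖ * ‖η‖ ≤ ∑ i, e i * w i)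
    (hw : ∀ i, |w i| ≤ L * (‖e‖ + ‖η‖))
    (hks : ∀ i, 0 ≤ ks i) (hkc : ∀ i, ks i ≤ c i) (hθc : ∀ i, θ ≤ c i) :
    ∑ i, e i * (-w i + (ks i + c i) * q i) +
      ∑ i, ∑ j, η i j * (-(θ * θbar i j) *
        (∑ k, a i k * (η i j - η k j) + a i j * (η i j - q j)) -
          (-w j + (ks j + c j) * q j)) / θbar i j ≤
    -m * ‖e‖ ^ 2 - (θ * l - N ^ 2 * b * L) * ‖η‖ ^ 2 + (N * L + N ^ 2 * b * L) * (‖e‖ * ‖η‖) +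
      (2 + N * ab + 2 * b * N) * (‖e‖ + ‖η‖) * ∑ i, c i * |q i| := by
  have hb0 : 0 ≤ b := (inv_nonneg.2 (hθbar ⟨0, hN⟩ ⟨0, hN⟩).le).trans (hb _ _)
  have hab0 : 0 ≤ ab := (ha ⟨0, hN⟩ ⟨0, hN⟩).trans (hab _ _)
  set Q := ∑ i, c i * |q i| with hQ
  have hc0 : ∀ i, 0 ≤ c i := fun i => (hks i).trans (hkc i)
  have hQ0 : 0 ≤ Q := Finset.sum_nonneg fun i _ => mul_nonneg (hc0 i) (abs_nonneg _)
  set X := ‖e‖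
  set Y := ‖η‖
  have hX : 0 ≤ X := norm_nonneg _
  have hY : 0 ≤ Y := norm_nonneg _
  have hkcq : ∀ i, |(ks i + c i) * q i| ≤ 2 * (c i * |q i|) := by
    intro i
    rw [abs_mul, abs_of_nonneg (add_nonneg (hks i) (hc0 i))]
    nlinarith [hkc i, abs_nonneg (q i)]
  have T1 : ∑ i, e i * (-w i + (ks i + c i) * q i) ≤
      -(m * X ^ 2 - N * L * X * Y) + X * (2 * Q) := by
    have e1 : ∑ i, e i * (-w i + (ks i + c i) * q i)
        = -∑ i, e i * w i + ∑ i, e i * ((ks i + c i) * q i) := by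
      rw [← Finset.sum_neg_distrib, ← Finset.sum_add_distrib]
      exact Finset.sum_congr rfl fun i _ => by ring
    have e2 : ∑ i, e i * ((ks i + c i) * q i) ≤ X * (2 * Q) := by
      rw [hQ, Finset.mul_sum, Finset.mul_sum]
      refine Finset.sum_le_sum fun i _ => (le_abs_self _).trans ?_
      rw [abs_mul]
      exact mul_le_mul (abs_le_pi_norm e i) (hkcq i) (abs_nonneg _) hX
    rw [e1]
    linarith
  -- The weight 1/θbar in the energy cancels the θbar in the estimator gains and restores the
  -- symmetric Laplacian form, multiplied by θ.
  have T2 : ∑ i, ∑ j, η i j * (-(θ * θbar i j) *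
        (∑ k, a i k * (η i j - η k j) + a i j * (η i j - q j)) -
          (-w j + (ks j + c j) * q j)) / θbar i j
      = -(θ * ∑ i, ∑ j, η i j * (∑ k, a i k * (η i j - η k j) + a i j * η i j)) +
        ∑ i, ∑ j, (θ * a i j * η i j * q j +
          (θbar i j)⁻¹ * (η i j * w j) - (θbar i j)⁻¹ * (η i j * ((ks j + c j) * q j))) := by
    rw [Finset.mul_sum, ← Finset.sum_neg_distrib, ← Finset.sum_add_distrib]
    refine Finset.sum_congr rfl fun i _ => ?_
    rw [Finset.mul_sum, ← Finset.sum_neg_distrib, ← Finset.sum_add_distrib]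
    refine Finset.sum_congr rfl fun j _ => ?_
    have := (hθbar i j).ne'
    field_simp
    ring
  have T3 : ∑ i, ∑ j, (θ * a i j * η i j * q j +
          (θbar i j)⁻¹ * (η i j * w j) - (θbar i j)⁻¹ * (η i j * ((ks j + c j) * q j))) ≤
      ∑ _i : Fin N, ∑ j, (ab * Y * (c j * |q j|) + b * (Y * (L * (X + Y))) +
        b * (Y * (2 * (c j * |q j|)))) := by
    refine Finset.sum_le_sum fun i _ => Finset.sum_le_sum fun j _ => ?_
    have hη := abs_le_pi_norm₂ η i j
    have hi0 : 0 ≤ (θbar i j)⁻¹ := inv_nonneg.2 (hθbar i j).le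
    have u1 : θ * a i j * η i j * q j ≤ ab * Y * (c j * |q j|) := by
      calc θ * a i j * η i j * q j ≤ |θ * a i j * η i j * q j| := le_abs_self _
        _ = a i j * |η i j| * (θ * |q j|) := by
          rw [abs_mul, abs_mul, abs_mul, abs_of_nonneg hθ, abs_of_nonneg (ha i j)]; ring
        _ ≤ ab * Y * (c j * |q j|) := by
          have := hab i j
          have := hθc j
          have := ha i j
          gcongr
    have u2 : (θbar i j)⁻¹ * (η i j * w j) ≤ b * (Y * (L * (X + Y))) := by
      calc _ ≤ |(θbar i j)⁻¹ * (η i j * w j)| := le_abs_self _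
        _ = (θbar i j)⁻¹ * (|η i j| * |w j|) := by rw [abs_mul, abs_mul, abs_of_nonneg hi0]
        _ ≤ _ := by
          have := hb i j
          have := hw j
          gcongr
    have u3 : -((θbar i j)⁻¹ * (η i j * ((ks j + c j) * q j))) ≤
        b * (Y * (2 * (c j * |q j|))) := by
      calc _ ≤ |(θbar i j)⁻¹ * (η i j * ((ks j + c j) * q j))| := neg_le_abs _
        _ = (θbar i j)⁻¹ * (|η i j| * |(ks j + c j) * q j|) := by
          rw [abs_mul, abs_mul, abs_of_nonneg hi0]
        _ ≤ _ := by
          have := hb i j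
          have := hkcq j
          gcongr
    linarith
  have T4 : ∑ _i : Fin N, ∑ j, (ab * Y * (c j * |q j|) + b * (Y * (L * (X + Y))) +
        b * (Y * (2 * (c j * |q j|)))) =
      N * (ab * Y * Q + b * (Y * (2 * Q))) + N ^ 2 * (b * (Y * (L * (X + Y)))) := by
    have : ∑ j, (ab * Y * (c j * |q j|) + b * (Y * (L * (X + Y))) +
        b * (Y * (2 * (c j * |q j|)))) =
        ab * Y * Q + N * (b * (Y * (L * (X + Y)))) + b * (Y * (2 * Q)) := by
      rw [Finset.sum_add_distrib, Finset.sum_add_distrib]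
      simp only [← Finset.mul_sum, ← hQ, Finset.sum_const, Finset.card_univ, Fintype.card_fin,
        nsmul_eq_mul]
      ring
    rw [this]
    simp only [Finset.sum_const, Finset.card_univ, Fintype.card_fin, nsmul_eq_mul]
    ring
  have T5 := mul_le_mul_of_nonneg_left (consensus_form_ge hl hl0 η) hθ
  have hN0 : (0 : ℝ) ≤ N := Nat.cast_nonneg N
  have v1 : 0 ≤ (N * ab + 2 * b * N) * X * Q := by positivity
  have v2 : 0 ≤ 2 * Y * Q := by positivity
  rw [T2]
  rw [T4] at T3
  nlinarith

/-- Because |p| ≤ P√β, the product p r/β gains a factor 1/√β on the Q part of r. On its X part,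
Young's inequality costs half of the damping k p²/β and a multiple of X² of order 1/β. -/
theorem observer_rate_le {p q h r d₁ d₂ s k c β Q X δ ε ε' P R₁ R₂ M : ℝ} (hβ : 0 < β)
    (hsq : s * q = |q|) (hs : |s| ≤ 1) (hq : |q| ≤ Q) (hc : 0 ≤ c) (hcq : c * |q| ≤ Q)
    (hh : |h| ≤ δ * Q) (hr : |r| ≤ R₁ * Q + R₂ * X)
    (hp : |p| ≤ P * √β) (hd₁ : |d₁| ≤ M) (hd₂ : |d₂| ≤ M) (hk : 1 ≤ k) (hR₁ : 0 ≤ R₁)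
    (hβ₁ : P * R₁ ≤ ε * √β) (hβ₂ : R₂ ^ 2 ≤ 2 * ε' * β) (hβ₃ : M * (δ + 2) ≤ ε * β) :
    p * (-k * p + r + d₁ - β * s) / β + s * (p + h - c * q) -
        ((p + h - c * q) * d₁ + q * d₂) / β ≤
      -(k * (p ^ 2 / (2 * β))) - c * |q| + (δ + 2 * ε) * Q + ε' * X ^ 2 := by
  have hQ : 0 ≤ Q := (abs_nonneg q).trans hq
  have hM : 0 ≤ M := (abs_nonneg _).trans hd₁
  -- The terms ±p s and ±p d₁/β cancel here; this dictates the form of the observer energy.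
  have e : p * (-k * p + r + d₁ - β * s) / β + s * (p + h - c * q) -
        ((p + h - c * q) * d₁ + q * d₂) / β =
      -(k * p ^ 2) / β + p * r / β + s * h - c * |q| - (h * d₁ - c * (q * d₁) + q * d₂) / β := by
    rw [← hsq]
    field_simp
    ring
  have h1 : s * h ≤ δ * Q := by
    refine (le_abs_self _).trans ?_
    rw [abs_mul]
    calc |s| * |h| ≤ 1 * |h| := by gcongr
      _ ≤ _ := by linarith
  have h2 : -(h * d₁ - c * (q * d₁) + q * d₂) / β ≤ ε * Q := by
    rw [div_le_iff₀ hβ]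
    have a1 : |h * d₁| ≤ δ * Q * M := by
      rw [abs_mul]; exact mul_le_mul hh hd₁ (abs_nonneg _) ((abs_nonneg _).trans hh)
    have a2 : |c * (q * d₁)| ≤ Q * M := by
      rw [abs_mul, abs_mul, abs_of_nonneg hc, ← mul_assoc]
      exact mul_le_mul hcq hd₁ (abs_nonneg _) hQ
    have a3 : |q * d₂| ≤ Q * M := by
      rw [abs_mul]; exact mul_le_mul hq hd₂ (abs_nonneg _) hQ
    have a4 : M * (δ + 2) * Q ≤ ε * β * Q := by gcongr
    have b1 := neg_le_abs (h * d₁)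
    have b2 := le_abs_self (c * (q * d₁))
    have b3 := neg_le_abs (q * d₂)
    linarith
  have hsβ : 0 < √β := Real.sqrt_pos.2 hβ
  have hss : √β * √β = β := Real.mul_self_sqrt hβ.le
  have h3 : p * r / β ≤ ε * Q + k * p ^ 2 / (2 * β) + ε' * X ^ 2 := by
    have c1 : p * r ≤ |p| * (R₁ * Q) + |p| * (R₂ * X) := by
      calc p * r ≤ |p| * |r| := by rw [← abs_mul]; exact le_abs_self _
        _ ≤ |p| * (R₁ * Q + R₂ * X) := by gcongr
        _ = _ := by ring
    have c2 : |p| * (R₁ * Q) ≤ ε * Q * β := by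
      calc |p| * (R₁ * Q) ≤ P * √β * (R₁ * Q) := by gcongr
        _ = (P * R₁) * (√β * Q) := by ring
        _ ≤ (ε * √β) * (√β * Q) := by gcongr
        _ = ε * Q * (√β * √β) := by ring
        _ = _ := by rw [hss]
    have c3 : |p| * (R₂ * X) ≤ k * p ^ 2 / 2 + ε' * X ^ 2 * β := by
      have : |p| ^ 2 = p ^ 2 := sq_abs p
      have t1 : |p| * (R₂ * X) ≤ |p| ^ 2 / 2 + R₂ ^ 2 * X ^ 2 / 2 := by
        nlinarith [sq_nonneg (|p| - R₂ * X)]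
      have t2 : R₂ ^ 2 * X ^ 2 ≤ 2 * ε' * β * X ^ 2 := by gcongr
      have t3 : 0 ≤ (k - 1) * p ^ 2 := mul_nonneg (by linarith) (sq_nonneg _)
      rw [this] at t1
      nlinarith
    have c4 : k * p ^ 2 / (2 * β) * β = k * p ^ 2 / 2 := by field_simp
    rw [div_le_iff₀ hβ, add_mul, add_mul, c4]
    linarith
  have h4 : -(k * p ^ 2) / β + k * p ^ 2 / (2 * β) = -(k * (p ^ 2 / (2 * β))) := by
    field_simp
    ring
  have h5 : -(h * d₁ - c * (q * d₁) + q * d₂) / β = -((h * d₁ - c * (q * d₁) + q * d₂) / β) := by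
    ring
  rw [e]
  linarith

end

/-! ### Size of the Lyapunov function and its combined rate. -/

section

variable {N : ℕ} {a θbar : Matrix (Fin N) (Fin N) ℝ} {e q w p d₁ d₂ s h r ks c β : Fin N → ℝ}
  {η : Fin N → Fin N → ℝ} {m L l b ab θ A κ M : ℝ}

theorem lyapunov_le (hN : 0 < N) (hθbar : ∀ i j, 0 < θbar i j) (hb : ∀ i j, (θbar i j)⁻¹ ≤ b)
    (hA : 0 ≤ A) (hβ : ∀ i, 0 < β i) (hd₁ : ∀ i, |d₁ i| ≤ M) (hM : ∀ i, 2 * M ≤ β i) :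
    lyapunov θbar A β e q p d₁ η ≤ N / 2 * ‖e‖ ^ 2 + N ^ 2 * b / 2 * ‖η‖ ^ 2 +
      A * (∑ i, p i ^ 2 / (2 * β i) + 3 / 2 * ∑ i, |q i|) := by
  have hb0 : 0 ≤ b := (inv_nonneg.2 (hθbar ⟨0, hN⟩ ⟨0, hN⟩).le).trans (hb _ _)
  have h1 : ∑ i, e i ^ 2 / 2 ≤ N / 2 * ‖e‖ ^ 2 := by
    calc ∑ i, e i ^ 2 / 2 ≤ ∑ _i : Fin N, ‖e‖ ^ 2 / 2 := by
          refine Finset.sum_le_sum fun i _ => ?_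
          have := abs_le_pi_norm e i
          rw [← sq_abs (e i)]
          gcongr
      _ = _ := by
          simp only [Finset.sum_const, Finset.card_univ, Fintype.card_fin, nsmul_eq_mul]
          ring
  have h2 : ∑ i, ∑ j, η i j ^ 2 / (2 * θbar i j) ≤ N ^ 2 * b / 2 * ‖η‖ ^ 2 := by
    calc ∑ i, ∑ j, η i j ^ 2 / (2 * θbar i j)
        ≤ ∑ _i : Fin N, ∑ _j : Fin N, b / 2 * ‖η‖ ^ 2 := by
          refine Finset.sum_le_sum fun i _ => Finset.sum_le_sum fun j _ => ?_
          have h3 := abs_le_pi_norm₂ η i j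
          have h4 := hb i j
          have h5 := hθbar i j
          have : η i j ^ 2 / (2 * θbar i j) = (θbar i j)⁻¹ / 2 * |η i j| ^ 2 := by
            rw [sq_abs]; field_simp
          rw [this]
          gcongr
      _ = _ := by
          simp only [Finset.sum_const, Finset.card_univ, Fintype.card_fin, nsmul_eq_mul]
          ring
  have h3 : ∑ i, (p i ^ 2 / (2 * β i) + |q i| - q i * d₁ i / β i) ≤
      ∑ i, p i ^ 2 / (2 * β i) + 3 / 2 * ∑ i, |q i| := by
    rw [Finset.mul_sum, ← Finset.sum_add_distrib]
    refine Finset.sum_le_sum fun i _ => ?_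
    have : -(q i * d₁ i / β i) ≤ |q i| / 2 := by
      rw [← neg_div, div_le_iff₀ (hβ i)]
      have t1 := neg_le_abs (q i * d₁ i)
      rw [abs_mul] at t1
      have t2 := mul_le_mul_of_nonneg_left (hd₁ i) (abs_nonneg (q i))
      have t3 := mul_le_mul_of_nonneg_left (hM i) (abs_nonneg (q i))
      linarith
    linarith
  have h4 := mul_le_mul_of_nonneg_left h3 hA
  unfold lyapunov
  linarith

/-- With β ≥ 2M the indefinite term q d₁/β is at most |q|/2, so the energy is positive. The bounds
on e, η and q are free of β; only the bound on p carries √β. -/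
theorem lyapunov_bounds (hθbar : ∀ i j, 0 < θbar i j) {b' : ℝ} (hb' : ∀ i j, θbar i j ≤ b')
    (hb'0 : 0 ≤ b')
    (hA : 1 ≤ A) (hβ : ∀ i, 0 < β i) (hd₁ : ∀ i, |d₁ i| ≤ M) (hM : ∀ i, 2 * M ≤ β i)
    {U : ℝ} (hU : lyapunov θbar A β e q p d₁ η ≤ U) :
    0 ≤ U ∧ ‖e‖ ≤ √2 * √U ∧ ‖η‖ ≤ √(2 * b') * √U ∧ (∀ i, |q i| ≤ 2 * U) ∧
      ∀ i, |p i| ≤ √(2 * U) * √(β i) := by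
  have n1 : 0 ≤ ∑ i, e i ^ 2 / 2 := Finset.sum_nonneg fun i _ => by positivity
  have n2 : ∀ i j, 0 ≤ η i j ^ 2 / (2 * θbar i j) := fun i j => by
    have := hθbar i j
    positivity
  have n3 : 0 ≤ ∑ i, ∑ j, η i j ^ 2 / (2 * θbar i j) :=
    Finset.sum_nonneg fun i _ => Finset.sum_nonneg fun j _ => n2 i j
  have n4 : ∀ i, p i ^ 2 / (2 * β i) + |q i| / 2 ≤
      p i ^ 2 / (2 * β i) + |q i| - q i * d₁ i / β i := by
    intro i
    have : q i * d₁ i / β i ≤ |q i| / 2 := by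
      rw [div_le_iff₀ (hβ i)]
      have t1 := le_abs_self (q i * d₁ i)
      rw [abs_mul] at t1
      have t2 := mul_le_mul_of_nonneg_left (hd₁ i) (abs_nonneg (q i))
      have t3 := mul_le_mul_of_nonneg_left (hM i) (abs_nonneg (q i))
      linarith
    linarith
  have n5 : ∀ i, 0 ≤ p i ^ 2 / (2 * β i) := fun i => by
    have := hβ i
    positivity
  have n6 : ∀ i, 0 ≤ p i ^ 2 / (2 * β i) + |q i| - q i * d₁ i / β i := fun i =>
    (add_nonneg (n5 i) (by positivity)).trans (n4 i)
  set Z := ∑ i, (p i ^ 2 / (2 * β i) + |q i| - q i * d₁ i / β i) with hZ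
  have n7 : 0 ≤ Z := Finset.sum_nonneg fun i _ => n6 i
  have n8 : Z ≤ A * Z := by nlinarith
  unfold lyapunov at hU
  rw [← hZ] at hU
  have hU0 : 0 ≤ U := by linarith
  have hzi : ∀ i, p i ^ 2 / (2 * β i) + |q i| / 2 ≤ U := by
    intro i
    have := Finset.single_le_sum (f := fun i => p i ^ 2 / (2 * β i) + |q i| - q i * d₁ i / β i)
      (fun i _ => n6 i) (Finset.mem_univ i)
    have h4 := n4 i
    linarith
  refine ⟨hU0, ?_, ?_, fun i => ?_, fun i => ?_⟩
  · rw [← Real.sqrt_mul (by norm_num)]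
    refine Real.le_sqrt_of_sq_le ?_
    have := sq_norm_le_sum e
    rw [← Finset.sum_div] at n1 hU
    linarith
  · rw [← Real.sqrt_mul (by positivity)]
    refine Real.le_sqrt_of_sq_le ?_
    have h1 := sq_norm_le_sum₂ η
    have h2 : ∑ i, ∑ j, η i j ^ 2 ≤ 2 * b' * ∑ i, ∑ j, η i j ^ 2 / (2 * θbar i j) := by
      simp only [Finset.mul_sum]
      refine Finset.sum_le_sum fun i _ => Finset.sum_le_sum fun j _ => ?_
      have h3 : η i j ^ 2 = 2 * θbar i j * (η i j ^ 2 / (2 * θbar i j)) := by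
        have := (hθbar i j).ne'
        field_simp
      calc η i j ^ 2 = 2 * θbar i j * (η i j ^ 2 / (2 * θbar i j)) := h3
        _ ≤ _ := mul_le_mul_of_nonneg_right (by linarith [hb' i j]) (n2 i j)
    have h3 : ∑ i, ∑ j, η i j ^ 2 / (2 * θbar i j) ≤ U := by linarith
    have h4 : 2 * b' * ∑ i, ∑ j, η i j ^ 2 / (2 * θbar i j) ≤ 2 * b' * U := by gcongr
    linarith
  · linarith [hzi i, n5 i]
  · rw [← Real.sqrt_mul (by positivity)]
    refine Real.le_sqrt_of_sq_le ?_
    have h1 : p i ^ 2 / (2 * β i) ≤ U := by linarith [hzi i, abs_nonneg (q i)]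
    rw [div_le_iff₀ (by linarith [hβ i])] at h1
    rw [sq_abs]
    linarith

set_option maxHeartbeats 1000000 in
-- The smallness hypothesis `hX` lets A/4 of the observer's dissipation absorb the forcing of the
-- seeking part.
theorem lyapunov_rate_le (hN : 0 < N) (hθbar : ∀ i j, 0 < θbar i j)
    (hb : ∀ i j, (θbar i j)⁻¹ ≤ b)
    (ha : ∀ i j, 0 ≤ a i j) (hab : ∀ i j, a i j ≤ ab)
    (hl : ∀ (j : Fin N) (v : Fin N → ℝ),
      l * ‖v‖ ^ 2 ≤ ∑ i, v i * (∑ k, a i k * (v i - v k) + a i j * v i)) (hl0 : 0 ≤ l)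
    (hθ : 0 ≤ θ) (hm : 0 < m)
    (hθl : N ^ 2 * b * L + (N * L + N ^ 2 * b * L) ^ 2 / (2 * m) + 1 ≤ θ * l)
    (hew : m * ‖e‖ ^ 2 - N * L * ‖e‖ * ‖η‖ ≤ ∑ i, e i * w i)
    (hw : ∀ i, |w i| ≤ L * (‖e‖ + ‖η‖))
    (hA : 0 ≤ A) (hX : (2 + N * ab + 2 * b * N) * (‖e‖ + ‖η‖) ≤ A / 4)
    (hks : ∀ i, 1 ≤ ks i) (hkc : ∀ i, ks i ≤ c i) (hθc : ∀ i, θ ≤ c i)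
    (hβ : ∀ i, 0 < β i) (hsq : ∀ i, s i * q i = |q i|) (hs : ∀ i, |s i| ≤ 1)
    {δ ε ε' P R₁ R₂ : ℝ}
    (hh : ∀ i, |h i| ≤ δ * ∑ j, c j * |q j|)
    (hr : ∀ i, |r i| ≤ R₁ * ∑ j, c j * |q j| + R₂ * (‖e‖ + ‖η‖))
    (hp : ∀ i, |p i| ≤ P * √(β i)) (hd₁ : ∀ i, |d₁ i| ≤ M) (hd₂ : ∀ i, |d₂ i| ≤ M)
    (hR₁ : 0 ≤ R₁) (hβ₁ : ∀ i, P * R₁ ≤ ε * √(β i)) (hβ₂ : ∀ i, R₂ ^ 2 ≤ 2 * ε' * β i)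
    (hβ₃ : ∀ i, M * (δ + 2) ≤ ε * β i) (hM : ∀ i, 2 * M ≤ β i)
    (hδ : N * (δ + 2 * ε) ≤ 1 / 2) (hε₁ : A * (N * ε') * 2 ≤ m / 4)
    (hε₂ : A * (N * ε') * 2 ≤ 1 / 2) (hε' : 0 ≤ ε')
    (hκ : 0 ≤ κ) (hκ₁ : κ * (N / 2) ≤ m / 4) (hκ₂ : κ * (N ^ 2 * b / 2) ≤ 1 / 2)
    (hκ₃ : κ ≤ 1 / 6) :
    lyapunovRate θbar A β s e q p d₁ η (fun i => -w i + (ks i + c i) * q i)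
      (fun i => p i + h i - c i * q i) (fun i => -ks i * p i + r i + d₁ i - β i * s i) d₂
      (fun i j => -(θ * θbar i j) *
        (∑ k, a i k * (η i j - η k j) + a i j * (η i j - q j)) - (-w j + (ks j + c j) * q j)) ≤
    -κ * lyapunov θbar A β e q p d₁ η := by
  unfold lyapunovRate
  beta_reduce
  have hb0 : 0 ≤ b := (inv_nonneg.2 (hθbar ⟨0, hN⟩ ⟨0, hN⟩).le).trans (hb _ _)
  have hab0 : 0 ≤ ab := (ha ⟨0, hN⟩ ⟨0, hN⟩).trans (hab _ _)
  have H1 := seeking_rate_le (q := q) hN hθbar hb ha hab hl hl0 hθ hew hw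
    (fun i => zero_le_one.trans (hks i)) hkc hθc
  have H2 := lyapunov_le (e := e) (q := q) (p := p) (η := η) hN hθbar hb hA hβ hd₁ hM
  have hc1 : ∀ i, 1 ≤ c i := fun i => (hks i).trans (hkc i)
  set Q := ∑ i, c i * |q i| with hQ
  have hcq : ∀ i, c i * |q i| ≤ Q := fun i =>
    Finset.single_le_sum (f := fun i => c i * |q i|)
      (fun i _ => mul_nonneg (by linarith [hc1 i]) (abs_nonneg _)) (Finset.mem_univ i)
  have hq : ∀ i, |q i| ≤ c i * |q i| := fun i => by nlinarith [hc1 i, abs_nonneg (q i)]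
  have hQ1 : ∑ i, |q i| ≤ Q := Finset.sum_le_sum fun i _ => hq i
  have hQ0 : 0 ≤ Q := (Finset.sum_nonneg fun i _ => abs_nonneg (q i)).trans hQ1
  set X := ‖e‖
  set Y := ‖η‖
  have hX0 : 0 ≤ X := norm_nonneg _
  have hY0 : 0 ≤ Y := norm_nonneg _
  set W := ∑ i, p i ^ 2 / (2 * β i) with hW
  have hW0 : 0 ≤ W := Finset.sum_nonneg fun i _ => by
    have := hβ i
    positivity
  have H3 : ∑ i, (p i * (-ks i * p i + r i + d₁ i - β i * s i) / β i +
        s i * (p i + h i - c i * q i) -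
        ((p i + h i - c i * q i) * d₁ i + q i * d₂ i) / β i) ≤
      -W - Q / 2 + N * ε' * (X + Y) ^ 2 := by
    calc _ ≤ ∑ i, (-(p i ^ 2 / (2 * β i)) - c i * |q i| +
          ((δ + 2 * ε) * Q + ε' * (X + Y) ^ 2)) := by
          refine Finset.sum_le_sum fun i _ => ?_
          have h1 := observer_rate_le (hβ i) (hsq i) (hs i) ((hq i).trans (hcq i))
            (by linarith [hc1 i]) (hcq i) (hh i) (hr i) (hp i) (hd₁ i) (hd₂ i) (hks i) hR₁
            (hβ₁ i) (hβ₂ i) (hβ₃ i)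
          have h2 : 0 ≤ p i ^ 2 / (2 * β i) := by
            have := hβ i
            positivity
          have h3 := mul_le_mul_of_nonneg_right (hks i) h2
          linarith
      _ = -W - Q + N * ((δ + 2 * ε) * Q + ε' * (X + Y) ^ 2) := by
          rw [Finset.sum_add_distrib, Finset.sum_sub_distrib, Finset.sum_neg_distrib, ← hW, ← hQ]
          simp only [Finset.sum_const, Finset.card_univ, Fintype.card_fin, nsmul_eq_mul]
      _ ≤ _ := by
          have := mul_le_mul_of_nonneg_right hδ hQ0
          linarith
  have H4 := mul_le_mul_of_nonneg_left H3 hA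
  have H5 : (X + Y) ^ 2 ≤ 2 * X ^ 2 + 2 * Y ^ 2 := by nlinarith [sq_nonneg (X - Y)]
  have H6 : A * (N * ε' * (X + Y) ^ 2) ≤ m / 4 * X ^ 2 + 1 / 2 * Y ^ 2 := by
    have t0 : 0 ≤ A * (N * ε') := by positivity
    have t1 := mul_le_mul_of_nonneg_left H5 t0
    have t2 := mul_le_mul_of_nonneg_right hε₁ (sq_nonneg X)
    have t3 := mul_le_mul_of_nonneg_right hε₂ (sq_nonneg Y)
    linarith
  have H7 : (2 + N * ab + 2 * b * N) * (X + Y) * Q ≤ A / 4 * Q := by gcongr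
  have H8 : (N * L + N ^ 2 * b * L) * (X * Y) ≤
      m / 2 * X ^ 2 + (N * L + N ^ 2 * b * L) ^ 2 / (2 * m) * Y ^ 2 := by
    set K := N * L + N ^ 2 * b * L
    have : m / 2 * X ^ 2 + K ^ 2 / (2 * m) * Y ^ 2 - K * (X * Y) =
        (m * X - K * Y) ^ 2 / (2 * m) := by
      field_simp
      ring
    have h2 : 0 ≤ (m * X - K * Y) ^ 2 / (2 * m) := by positivity
    linarith
  have H9 := mul_le_mul_of_nonneg_right hθl (sq_nonneg Y)
  have H10 := mul_le_mul_of_nonneg_left H2 hκ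
  have k1 := mul_le_mul_of_nonneg_right hκ₁ (sq_nonneg X)
  have k2 := mul_le_mul_of_nonneg_right hκ₂ (sq_nonneg Y)
  have k3 : κ * (A * W) ≤ A * W := by
    have : 0 ≤ A * W := by positivity
    calc κ * (A * W) ≤ 1 * (A * W) := by gcongr; linarith
      _ = A * W := one_mul _
  have k4 : κ * (A * ∑ i, |q i|) ≤ 1 / 6 * (A * Q) := by
    have t1 : 0 ≤ A * Q := by positivity
    calc κ * (A * ∑ i, |q i|) ≤ κ * (A * Q) := by gcongr
      _ ≤ _ := by gcongr
  -- Budget. For ‖e‖²: of m, Young takes m/2 and ε' takes m/4. For ‖η‖²: the 1 left over by the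
  -- condition on θ loses 1/2 to ε'. For Q: of A/2, the forcing takes A/4. The remainders m/4, 1/2,
  -- A/4 and all of A W dominate κ times the upper bound of the energy.
  linarith

end

theorem exists_lipschitz_on_closedBall {N : ℕ} {F : Fin N → (Fin N → ℝ) → ℝ}
    (hF : ∀ i, ContDiff ℝ 1 (F i)) (x₀ : Fin N → ℝ) (R : ℝ) :
    ∃ L : ℝ, 0 ≤ L ∧ ∀ i, (∀ x ∈ Metric.closedBall x₀ R, ‖fderiv ℝ (F i) x‖ ≤ L) ∧
      ∀ x ∈ Metric.closedBall x₀ R, ∀ z ∈ Metric.closedBall x₀ R,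
        |F i x - F i z| ≤ L * ‖x - z‖ := by
  have h : ∀ i, ∃ C : ℝ, ∀ x ∈ Metric.closedBall x₀ R, ‖fderiv ℝ (F i) x‖ ≤ C := fun i =>
    (isCompact_closedBall x₀ R).exists_bound_of_continuousOn
      ((hF i).continuous_fderiv one_ne_zero).continuousOn
  choose C hC using h
  have hle : ∀ i, C i ≤ ∑ j, |C j| := fun i => (le_abs_self _).trans
    (Finset.single_le_sum (f := fun j => |C j|) (fun j _ => abs_nonneg _) (Finset.mem_univ i))
  refine ⟨∑ j, |C j|, Finset.sum_nonneg fun j _ => abs_nonneg _, fun i =>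
    ⟨fun x hx => (hC i x hx).trans (hle i), fun x hx z hz => ?_⟩⟩
  exact (convex_closedBall x₀ R).norm_image_sub_le_of_norm_fderiv_le
    (fun y _ => (hF i).differentiable one_ne_zero y)
    (fun y hy => (hC i y hy).trans (hle i)) hz hx

/-! ### Differentiating the Lyapunov function. -/

section Calculus

variable {N : ℕ} {θbar : Matrix (Fin N) (Fin N) ℝ} {A : ℝ} {β : Fin N → ℝ}
  {e q p d : ℝ → Fin N → ℝ} {η : ℝ → Fin N → Fin N → ℝ}

theorem hasDerivAt_lyapunov {s e' q' p' d' : Fin N → ℝ} {η' : Fin N → Fin N → ℝ} {t : ℝ}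
    (he : ∀ i, HasDerivAt (fun τ => e τ i) (e' i) t)
    (hq : ∀ i, HasDerivAt (fun τ => q τ i) (q' i) t)
    (hqs : ∀ i, HasDerivAt (fun τ => |q τ i|) (s i * q' i) t)
    (hp : ∀ i, HasDerivAt (fun τ => p τ i) (p' i) t)
    (hd : ∀ i, HasDerivAt (fun τ => d τ i) (d' i) t)
    (hη : ∀ i j, HasDerivAt (fun τ => η τ i j) (η' i j) t) :
    HasDerivAt (fun τ => lyapunov θbar A β (e τ) (q τ) (p τ) (d τ) (η τ))
      (lyapunovRate θbar A β s (e t) (q t) (p t) (d t) (η t) e' q' p' d' η') t := by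
  unfold lyapunov lyapunovRate
  refine HasDerivAt.add (HasDerivAt.add (HasDerivAt.fun_sum fun i _ => ?_)
    (HasDerivAt.fun_sum fun i _ => HasDerivAt.fun_sum fun j _ => ?_))
    (HasDerivAt.const_mul _ (HasDerivAt.fun_sum fun i _ => HasDerivAt.sub (HasDerivAt.add ?_
      (hqs i)) (((hq i).mul (hd i)).div_const _)))
  · refine (((he i).pow 2).div_const 2).congr_deriv ?_
    simp; ring
  · refine (((hη i j).pow 2).div_const _).congr_deriv ?_
    simp; ring
  · refine (((hp i).pow 2).div_const _).congr_deriv ?_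
    simp; ring

theorem absolutelyContinuous_lyapunov {t₀ t : ℝ}
    (he : ∀ i, AbsolutelyContinuousOnInterval (fun τ => e τ i) t₀ t)
    (hq : ∀ i, AbsolutelyContinuousOnInterval (fun τ => q τ i) t₀ t)
    (hp : ∀ i, AbsolutelyContinuousOnInterval (fun τ => p τ i) t₀ t)
    (hd : ∀ i, AbsolutelyContinuousOnInterval (fun τ => d τ i) t₀ t)
    (hη : ∀ i j, AbsolutelyContinuousOnInterval (fun τ => η τ i j) t₀ t) :
    AbsolutelyContinuousOnInterval
      (fun τ => lyapunov θbar A β (e τ) (q τ) (p τ) (d τ) (η τ)) t₀ t := by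
  have hsq : ∀ {u : ℝ → ℝ} (k : ℝ), AbsolutelyContinuousOnInterval u t₀ t →
      AbsolutelyContinuousOnInterval (fun τ => u τ ^ 2 / k) t₀ t := by
    intro u k hu
    have h : (fun τ => u τ ^ 2 / k) = fun τ => k⁻¹ * (u τ * u τ) := by funext τ; ring
    rw [h]
    exact (hu.fun_mul hu).const_mul k⁻¹
  have hdiv : ∀ {u : ℝ → ℝ} (k : ℝ), AbsolutelyContinuousOnInterval u t₀ t →
      AbsolutelyContinuousOnInterval (fun τ => u τ / k) t₀ t := by
    intro u k hu
    have h : (fun τ => u τ / k) = fun τ => k⁻¹ * u τ := by funext τ; ring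
    rw [h]
    exact hu.const_mul k⁻¹
  unfold lyapunov
  exact ((absolutelyContinuous_sum _ fun i _ => hsq _ (he i)).fun_add
    (absolutelyContinuous_sum _ fun i _ => absolutelyContinuous_sum _ fun j _ => hsq _ (hη i j))).fun_add
    ((absolutelyContinuous_sum _ fun i _ => ((hsq _ (hp i)).fun_add
      (absolutelyContinuous_abs (hq i))).fun_sub (hdiv _ ((hq i).fun_mul (hd i)))).const_mul A)

end Calculus

/-! ### The closed loop in observer coordinates. -/

namespace Trajectory

variable {N : ℕ} (S : Trajectory N)

/-- The deviation of the observer state from the equilibrium. -/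
def errHat (xs : Fin N → ℝ) (t : ℝ) (i : Fin N) : ℝ := S.xhat t i - xs i

/-- The estimation error relative to the observer state. -/
def etaHat (t : ℝ) (i j : Fin N) : ℝ := S.y t i j - S.xhat t j

/-- The filtered signal `γ_i` minus the slowly decaying increment `g_i(x) - g_i(x̂)`. -/
def pHat (g : Fin N → (Fin N → ℝ) → ℝ) (d : Fin N → ℝ → ℝ) (ks : Fin N → ℝ) (t : ℝ)
    (i : Fin N) : ℝ :=
  g i (S.xhat t) + d i t - S.zhat t i - ks i * S.zeta1 t i

/-- The increment `g_i(x) - g_i(x̂)`. -/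
def gInc (g : Fin N → (Fin N → ℝ) → ℝ) (t : ℝ) (i : Fin N) : ℝ := g i (S.x t) - g i (S.xhat t)

/-- The derivative of the observer state. -/
noncomputable def xhatRate (f : Fin N → (Fin N → ℝ) → ℝ) (ks c : Fin N → ℝ) (t : ℝ)
    (i : Fin N) : ℝ :=
  -partialOwn f i (S.y t i) + (ks i + c i) * S.zeta1 t i

/-- The part of the derivative of `pHat` that is proportional to the error. -/
noncomputable def pRemainder (f g : Fin N → (Fin N → ℝ) → ℝ) (ks c : Fin N → ℝ) (t : ℝ)
    (i : Fin N) : ℝ :=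
  fderiv ℝ (g i) (S.xhat t) (S.xhatRate f ks c t) - ks i * S.gInc g t i

/-- The Lyapunov function along a trajectory. -/
noncomputable def lyap (g : Fin N → (Fin N → ℝ) → ℝ) (d : Fin N → ℝ → ℝ)
    (θbar : Matrix (Fin N) (Fin N) ℝ) (xs ks β : Fin N → ℝ) (A t₀ : ℝ) (t : ℝ) : ℝ :=
  lyapunov θbar A β (S.errHat xs t) (S.zeta1 t) (S.pHat g d ks t)
    (fun i => derivWithin (d i) (Ici t₀) t) (S.etaHat t)

/-- The derivative of `lyap`, for a selection `s` of the signum of `ζ₁`. -/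
noncomputable def lyapRate (f g : Fin N → (Fin N → ℝ) → ℝ) (d : Fin N → ℝ → ℝ)
    (a θbar : Matrix (Fin N) (Fin N) ℝ) (xs ks c β : Fin N → ℝ) (θ A t₀ : ℝ) (t : ℝ)
    (s : Fin N → ℝ) : ℝ :=
  lyapunovRate θbar A β s (S.errHat xs t) (S.zeta1 t) (S.pHat g d ks t)
    (fun i => derivWithin (d i) (Ici t₀) t) (S.etaHat t)
    (fun i => -partialOwn f i (S.y t i) + (ks i + c i) * S.zeta1 t i)
    (fun i => S.pHat g d ks t i + S.gInc g t i - c i * S.zeta1 t i)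
    (fun i => -ks i * S.pHat g d ks t i + S.pRemainder f g ks c t i +
      derivWithin (d i) (Ici t₀) t - β i * s i)
    (fun i => iteratedDerivWithin 2 (d i) (Ici t₀) t)
    (fun i j => -(θ * θbar i j) *
      (∑ k, a i k * (S.etaHat t i j - S.etaHat t k j) + a i j * (S.etaHat t i j - S.zeta1 t j)) -
        (-partialOwn f j (S.y t j) + (ks j + c j) * S.zeta1 t j))

namespace IsSolution

variable {S} {f g : Fin N → (Fin N → ℝ) → ℝ} {d : Fin N → ℝ → ℝ}
  {a θbar : Matrix (Fin N) (Fin N) ℝ} {θ t₀ : ℝ} {ks c β : Fin N → ℝ} {J : Set ℝ}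

theorem hasDerivWithinAt_xhat (hS : S.IsSolution f g d a θbar θ ks c β t₀ J) {t : ℝ} (ht : t ∈ J)
    (i : Fin N) : HasDerivWithinAt (fun τ => S.xhat τ i) (S.xhatRate f ks c t i) J t := by
  refine (hS.deriv_xhat t ht i).congr_deriv ?_
  simp only [u, xhatRate, zeta1]
  ring

theorem hasDerivWithinAt_zeta1 (hS : S.IsSolution f g d a θbar θ ks c β t₀ J) {t : ℝ}
    (ht : t ∈ J) (i : Fin N) : HasDerivWithinAt (fun τ => S.zeta1 τ i)
      (S.pHat g d ks t i + S.gInc g t i - c i * S.zeta1 t i) J t := by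
  refine ((hS.deriv_x t ht i).sub (hS.deriv_xhat t ht i)).congr_deriv ?_
  simp only [u, pHat, gInc, zeta1]
  ring

theorem hasDerivWithinAt_etaHat (hS : S.IsSolution f g d a θbar θ ks c β t₀ J) {t : ℝ}
    (ht : t ∈ J) (i j : Fin N) : HasDerivWithinAt (fun τ => S.etaHat τ i j)
      (-(θ * θbar i j) * (∑ k, a i k * (S.etaHat t i j - S.etaHat t k j) +
        a i j * (S.etaHat t i j - S.zeta1 t j)) - S.xhatRate f ks c t j) J t := by
  refine ((hS.deriv_y t ht i j).sub (hS.hasDerivWithinAt_xhat ht j)).congr_deriv ?_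
  simp only [etaHat, zeta1]
  congr 3
  · exact Finset.sum_congr rfl fun k _ => by ring
  · ring

theorem hasDerivWithinAt_g_xhat (hg : ∀ i, ContDiff ℝ 2 (g i))
    (hS : S.IsSolution f g d a θbar θ ks c β t₀ J) {t : ℝ} (ht : t ∈ J) (i : Fin N) :
    HasDerivWithinAt (fun τ => g i (S.xhat τ))
      (fderiv ℝ (g i) (S.xhat t) (S.xhatRate f ks c t)) J t := by
  have h1 : HasDerivWithinAt S.xhat (S.xhatRate f ks c t) J t :=
    hasDerivWithinAt_pi.2 fun j => hS.hasDerivWithinAt_xhat ht j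
  exact (((hg i).differentiable two_ne_zero) (S.xhat t)).hasFDerivAt.comp_hasDerivWithinAt t h1

section Disturbance

theorem contDiffOn_derivWithin_disturbance (hd : ∀ i, ContDiffOn ℝ 2 (d i) (Ici t₀))
    (i : Fin N) : ContDiffOn ℝ 1 (fun τ => derivWithin (d i) (Ici t₀) τ) (Ici t₀) :=
  (hd i).derivWithin (uniqueDiffOn_Ici t₀) (by norm_num)

theorem hasDerivAt_disturbance (hd : ∀ i, ContDiffOn ℝ 2 (d i) (Ici t₀)) (i : Fin N) {t : ℝ}
    (ht : t₀ < t) : HasDerivAt (d i) (derivWithin (d i) (Ici t₀) t) t :=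
  ((hd i).differentiableOn two_ne_zero t ht.le).hasDerivWithinAt.hasDerivAt (Ici_mem_nhds ht)

theorem hasDerivAt_derivWithin_disturbance (hd : ∀ i, ContDiffOn ℝ 2 (d i) (Ici t₀)) (i : Fin N)
    {t : ℝ} (ht : t₀ < t) : HasDerivAt (fun τ => derivWithin (d i) (Ici t₀) τ)
      (iteratedDerivWithin 2 (d i) (Ici t₀) t) t := by
  have h := (((contDiffOn_derivWithin_disturbance hd i).differentiableOn one_ne_zero)
    t ht.le).hasDerivWithinAt.hasDerivAt (Ici_mem_nhds ht)
  refine h.congr_deriv ?_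
  rw [iteratedDerivWithin_succ]
  congr 1
  funext τ
  rw [iteratedDerivWithin_one]

end Disturbance

theorem hasDerivAt_lyap (hg : ∀ i, ContDiff ℝ 2 (g i))
    (hd : ∀ i, ContDiffOn ℝ 2 (d i) (Ici t₀))
    (hS : S.IsSolution f g d a θbar θ ks c β t₀ J) (xs : Fin N → ℝ) (A : ℝ) {t : ℝ} (ht : t ∈ J)
    (ht₀ : t₀ < t) (hJ : J ∈ 𝓝 t) {s : Fin N → ℝ} (hs : ∀ i, s i ∈ sgnSet (S.zeta1 t i))
    (habs : ∀ i, DifferentiableAt ℝ (fun τ => |S.zeta1 τ i|) t)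
    (hz : ∀ i, HasDerivWithinAt (fun τ => S.zhat τ i)
      (ks i * c i * (S.x t i - S.xhat t i) + β i * s i) J t) :
    HasDerivAt (S.lyap g d θbar xs ks β A t₀) (S.lyapRate f g d a θbar xs ks c β θ A t₀ t s) t := by
  have hq : ∀ i, HasDerivAt (fun τ => S.zeta1 τ i)
      (S.pHat g d ks t i + S.gInc g t i - c i * S.zeta1 t i) t := fun i =>
    (hS.hasDerivWithinAt_zeta1 ht i).hasDerivAt hJ
  refine hasDerivAt_lyapunov (fun i => ?_) hq
    (fun i => hasDerivAt_abs_of_mem_sgnSet (hq i) (habs i) (hs i)) (fun i => ?_)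
    (fun i => hasDerivAt_derivWithin_disturbance hd i ht₀)
    (fun i j => (hS.hasDerivWithinAt_etaHat ht i j).hasDerivAt hJ)
  · exact ((hS.hasDerivWithinAt_xhat ht i).hasDerivAt hJ).sub_const _
  -- The summand -kˢ ζ₁ of `pHat` cancels the term kˢ c ζ₁ of the ẑ equation and produces the
  -- damping -kˢ p. Using g(x̂) in place of g(x) keeps p out of the remainder.
  · refine (((((hS.hasDerivWithinAt_g_xhat hg ht i).hasDerivAt hJ).add
      (hasDerivAt_disturbance hd i ht₀)).sub ((hz i).hasDerivAt hJ)).sub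
        ((hq i).const_mul (ks i))).congr_deriv ?_
    simp only [pRemainder, zeta1]
    ring

/-- All ingredients except ẑ have continuous derivatives on the compact interval; ẑ is absolutely
continuous by the notion of solution. -/
theorem absolutelyContinuous_lyap (hf : ∀ i, ContDiff ℝ 2 (f i)) (hg : ∀ i, ContDiff ℝ 2 (g i))
    (hd : ∀ i, ContDiffOn ℝ 2 (d i) (Ici t₀))
    (hS : S.IsSolution f g d a θbar θ ks c β t₀ J) (xs : Fin N → ℝ) (A : ℝ) {t : ℝ}
    (ht : t ∈ J) (ht₀ : t₀ ≤ t) (hJ : Icc t₀ t ⊆ J) :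
    AbsolutelyContinuousOnInterval (S.lyap g d θbar xs ks β A t₀) t₀ t ∧
      ∀ i, AbsolutelyContinuousOnInterval (fun τ => S.zeta1 τ i) t₀ t := by
  have cxi : ∀ i, ContinuousOn (fun τ => S.x τ i) (Icc t₀ t) := fun i τ hτ =>
    ((hS.deriv_x τ (hJ hτ) i).mono hJ).continuousWithinAt
  have cx : ContinuousOn S.x (Icc t₀ t) := continuousOn_pi.2 cxi
  have cxhi : ∀ i, ContinuousOn (fun τ => S.xhat τ i) (Icc t₀ t) := fun i τ hτ =>
    ((hS.deriv_xhat τ (hJ hτ) i).mono hJ).continuousWithinAt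
  have cxh : ContinuousOn S.xhat (Icc t₀ t) := continuousOn_pi.2 cxhi
  have cyi : ∀ i j, ContinuousOn (fun τ => S.y τ i j) (Icc t₀ t) := fun i j τ hτ =>
    ((hS.deriv_y τ (hJ hτ) i j).mono hJ).continuousWithinAt
  have cy : ∀ i, ContinuousOn (fun τ => S.y τ i) (Icc t₀ t) := fun i => continuousOn_pi.2 (cyi i)
  have cz : ∀ i, ContinuousOn (fun τ => S.zhat τ i) (Icc t₀ t) := fun i => by
    simpa [uIcc_of_le ht₀] using (hS.ac_zhat t ht i).continuousOn
  have cq : ∀ i, ContinuousOn (fun τ => S.zeta1 τ i) (Icc t₀ t) := fun i => (cxi i).sub (cxhi i)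
  have cη : ∀ i j, ContinuousOn (fun τ => S.etaHat τ i j) (Icc t₀ t) := fun i j =>
    (cyi i j).sub (cxhi j)
  have cF : ∀ i, ContinuousOn (fun τ => partialOwn f i (S.y τ i)) (Icc t₀ t) := fun i =>
    (contDiff_partialOwn (hf i)).continuous.comp_continuousOn (cy i)
  have cg : ∀ i, ContinuousOn (fun τ => g i (S.x τ)) (Icc t₀ t) := fun i =>
    (hg i).continuous.comp_continuousOn cx
  have cgh : ∀ i, ContinuousOn (fun τ => g i (S.xhat τ)) (Icc t₀ t) := fun i =>
    (hg i).continuous.comp_continuousOn cxh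
  have cd : ∀ i, ContinuousOn (d i) (Icc t₀ t) := fun i =>
    (hd i).continuousOn.mono Icc_subset_Ici_self
  have crate : ∀ i, ContinuousOn (fun τ => S.xhatRate f ks c τ i) (Icc t₀ t) := fun i =>
    (cF i).neg.add ((cq i).const_mul _)
  have cp : ∀ i, ContinuousOn (fun τ => S.pHat g d ks τ i) (Icc t₀ t) := fun i =>
    (((cgh i).add (cd i)).sub (cz i)).sub ((cq i).const_mul _)
  have aq : ∀ i, AbsolutelyContinuousOnInterval (fun τ => S.zeta1 τ i) t₀ t := fun i =>
    absolutelyContinuous_of_hasDerivWithinAt ht₀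
      (fun τ hτ => (hS.hasDerivWithinAt_zeta1 (hJ hτ) i).mono hJ)
      (((cp i).add ((cg i).sub (cgh i))).sub ((cq i).const_mul _))
  have axh : ∀ i, AbsolutelyContinuousOnInterval (fun τ => S.xhat τ i) t₀ t := fun i =>
    absolutelyContinuous_of_hasDerivWithinAt ht₀
      (fun τ hτ => (hS.hasDerivWithinAt_xhat (hJ hτ) i).mono hJ) (crate i)
  have agh : ∀ i, AbsolutelyContinuousOnInterval (fun τ => g i (S.xhat τ)) t₀ t := fun i =>
    absolutelyContinuous_of_hasDerivWithinAt ht₀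
      (fun τ hτ => (hS.hasDerivWithinAt_g_xhat hg (hJ hτ) i).mono hJ)
      ((((hg i).continuous_fderiv two_ne_zero).comp_continuousOn cxh).clm_apply
        (continuousOn_pi.2 crate))
  have aη : ∀ i j, AbsolutelyContinuousOnInterval (fun τ => S.etaHat τ i j) t₀ t := fun i j =>
    absolutelyContinuous_of_hasDerivWithinAt ht₀
      (fun τ hτ => (hS.hasDerivWithinAt_etaHat (hJ hτ) i j).mono hJ)
      (((((continuousOn_finsetSum _ fun k _ =>
        ((cη i j).sub (cη k j)).const_mul _).add (((cη i j).sub (cq j)).const_mul _)).const_mul _)).sub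
        (crate j))
  have hsub : uIcc t₀ t ⊆ Ici t₀ := by rw [uIcc_of_le ht₀]; exact Icc_subset_Ici_self
  have ad : ∀ i, AbsolutelyContinuousOnInterval (d i) t₀ t := fun i =>
    (((hd i).of_le (by norm_num)).mono hsub).absolutelyContinuousOnInterval
  have ad₁ : ∀ i, AbsolutelyContinuousOnInterval (fun τ => derivWithin (d i) (Ici t₀) τ) t₀ t :=
    fun i => ((contDiffOn_derivWithin_disturbance hd i).mono
      hsub).absolutelyContinuousOnInterval
  have aconst : ∀ k : ℝ, AbsolutelyContinuousOnInterval (fun _ => k) t₀ t := fun k =>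
    (LipschitzWith.const k).lipschitzOnWith.absolutelyContinuousOnInterval
  exact ⟨absolutelyContinuous_lyapunov (fun i => (axh i).fun_sub (aconst (xs i))) aq
    (fun i => (((agh i).fun_add (ad i)).fun_sub (hS.ac_zhat t ht i)).fun_sub
      ((aq i).const_mul (ks i))) ad₁ aη, aq⟩

theorem lyap_decay (hf : ∀ i, ContDiff ℝ 2 (f i)) (hg : ∀ i, ContDiff ℝ 2 (g i))
    (hd : ∀ i, ContDiffOn ℝ 2 (d i) (Ici t₀))
    (hS : S.IsSolution f g d a θbar θ ks c β t₀ J) {xs : Fin N → ℝ} {A κ B : ℝ} (hκ : 0 ≤ κ)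
    (h0 : 0 ≤ S.lyap g d θbar xs ks β A t₀ t₀) (hB : S.lyap g d θbar xs ks β A t₀ t₀ < B)
    (hrate : ∀ t ∈ Ici t₀, ∀ s : Fin N → ℝ, (∀ i, s i ∈ sgnSet (S.zeta1 t i)) →
      S.lyap g d θbar xs ks β A t₀ t ≤ B →
      S.lyapRate f g d a θbar xs ks c β θ A t₀ t s ≤ -κ * S.lyap g d θbar xs ks β A t₀ t)
    {t : ℝ} (ht : t ∈ J) (ht₀ : t₀ ≤ t) (hJ : Icc t₀ t ⊆ J) :
    S.lyap g d θbar xs ks β A t₀ t ≤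
      S.lyap g d θbar xs ks β A t₀ t₀ * Real.exp (-κ * (t - t₀)) := by
  obtain ⟨hU, hq⟩ := hS.absolutelyContinuous_lyap hf hg hd xs A ht ht₀ hJ
  refine exp_decay_of_barrier ht₀ hκ hU h0 hB ?_
  have hz := ae_all_iff.2 hS.deriv_zhat
  -- This discards the null set of times at which some |ζ₁| has a kink.
  have hq' := ae_all_iff.2 fun i => (absolutelyContinuous_abs (hq i)).ae_differentiableAt
  filter_upwards [hz, hq'] with τ h1 h2 hτ hle
  have hτJ : τ ∈ J := hJ ⟨hτ.1.le, hτ.2.le⟩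
  choose s hs hsz using fun i => h1 i hτJ
  refine ⟨_, hrate τ hτ.1.le s hs hle, hS.hasDerivAt_lyap hg hd xs A hτJ hτ.1
    (mem_of_superset (Icc_mem_nhds hτ.1 hτ.2) hJ) hs (fun i => h2 i ?_) hsz⟩
  rw [uIcc_of_le ht₀]
  exact ⟨hτ.1.le, hτ.2.le⟩

theorem gamma_eq (hS : S.IsSolution f g d a θbar θ ks c β t₀ J) (hJ : UniqueDiffOn ℝ J) {t : ℝ}
    (ht : t ∈ J) (i : Fin N) : S.gamma c J t i = S.pHat g d ks t i + S.gInc g t i := by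
  rw [gamma, (hS.hasDerivWithinAt_zeta1 ht i).derivWithin (hJ t ht)]
  ring

end IsSolution

end Trajectory

/-! ### Estimates along a trajectory inside the barrier. -/

namespace Trajectory

variable {N : ℕ} {S : Trajectory N} {f g : Fin N → (Fin N → ℝ) → ℝ} {d : Fin N → ℝ → ℝ}
  {a θbar : Matrix (Fin N) (Fin N) ℝ} {θ t₀ : ℝ} {xs ks c β : Fin N → ℝ} {J : Set ℝ}
  {m l b b' ab L G A B K M κ ε' ρ : ℝ}

/-- The Lipschitz constants of the gradients and of g are valid only on this ball, so every point at
which they are used must lie in it. -/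
theorem mem_closedBall_of_bounds {t R : ℝ} (he : ‖S.errHat xs t‖ + ‖S.etaHat t‖ + ‖S.zeta1 t‖ ≤ R) :
    S.x t ∈ Metric.closedBall xs R ∧ S.xhat t ∈ Metric.closedBall xs R ∧
      ∀ i, S.y t i ∈ Metric.closedBall xs R := by
  have n1 := norm_nonneg (S.errHat xs t)
  have n2 := norm_nonneg (S.etaHat t)
  have n3 := norm_nonneg (S.zeta1 t)
  have hx : S.x t - xs = S.errHat xs t + S.zeta1 t := by
    funext i
    simp only [errHat, zeta1, Pi.sub_apply, Pi.add_apply]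
    ring
  have hxh : S.xhat t - xs = S.errHat xs t := rfl
  have hy : ∀ i, S.y t i - xs = S.etaHat t i + S.errHat xs t := by
    intro i
    funext j
    simp only [errHat, etaHat, Pi.sub_apply, Pi.add_apply]
    ring
  simp only [mem_closedBall_iff_norm]
  refine ⟨?_, ?_, fun i => ?_⟩
  · rw [hx]
    linarith [norm_add_le (S.errHat xs t) (S.zeta1 t)]
  · rw [hxh]
    linarith
  · rw [hy]
    linarith [norm_add_le (S.etaHat t i) (S.errHat xs t), norm_le_pi_norm (S.etaHat t) i]

theorem abs_gInc_le {t : ℝ} {R : ℝ} (hG : ∀ i, ∀ x ∈ Metric.closedBall xs R,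
      ∀ z ∈ Metric.closedBall xs R, |g i x - g i z| ≤ G * ‖x - z‖)
    (he : ‖S.errHat xs t‖ + ‖S.etaHat t‖ + ‖S.zeta1 t‖ ≤ R) (i : Fin N) :
    |S.gInc g t i| ≤ G * ‖S.zeta1 t‖ := by
  obtain ⟨h1, h2, -⟩ := mem_closedBall_of_bounds he
  exact hG i _ h1 _ h2

theorem norm_le_of_lyap_le (hθbar : ∀ i j, 0 < θbar i j) (hb' : ∀ i j, θbar i j ≤ b')
    (hb'0 : 0 ≤ b') (hA : 1 ≤ A) (hβ : ∀ i, 0 < β i) {t : ℝ}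
    (hd₁ : ∀ i, |derivWithin (d i) (Ici t₀) t| ≤ M) (hM : ∀ i, 2 * M ≤ β i)
    (hU : S.lyap g d θbar xs ks β A t₀ t ≤ B) :
    0 ≤ B ∧ ‖S.errHat xs t‖ + ‖S.etaHat t‖ ≤ (√2 + √(2 * b')) * √B ∧ ‖S.zeta1 t‖ ≤ 2 * B ∧
      ∀ i, |S.pHat g d ks t i| ≤ √(2 * B) * √(β i) := by
  obtain ⟨h0, h1, h2, h3, h4⟩ := lyapunov_bounds hθbar hb' hb'0 hA hβ hd₁ hM hU
  exact ⟨h0, by linarith, (pi_norm_le_iff_of_nonneg (by positivity)).2 h3, h4⟩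

/-- Being below the barrier confines all points to the ball, where the local Lipschitz constants
supply the hypotheses of `lyapunov_rate_le`, with δ = 1/(4N), ε = 1/(8N), P = √(2B), R₁ = 2G +
K/(4N) and R₂ = GL. -/
theorem lyapRate_le (hN : 0 < N) (hm : 0 < m)
    (hmono : ∀ x z : Fin N → ℝ, m * ((x - z) ⬝ᵥ (x - z)) ≤
        (x - z) ⬝ᵥ (pseudoGradient f x - pseudoGradient f z))
    (hxs : pseudoGradient f xs = 0)
    (hθbar : ∀ i j, 0 < θbar i j) (hb : ∀ i j, (θbar i j)⁻¹ ≤ b)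
    (hb' : ∀ i j, θbar i j ≤ b') (hb'0 : 0 ≤ b')
    (ha : ∀ i j, 0 ≤ a i j) (hab : ∀ i j, a i j ≤ ab)
    (hl : ∀ (j : Fin N) (v : Fin N → ℝ),
      l * ‖v‖ ^ 2 ≤ ∑ i, v i * (∑ k, a i k * (v i - v k) + a i j * v i)) (hl0 : 0 ≤ l)
    {R : ℝ} (hL0 : 0 ≤ L) (hG0 : 0 ≤ G)
    (hL : ∀ i, ∀ x ∈ Metric.closedBall xs R, ∀ z ∈ Metric.closedBall xs R,
      |partialOwn f i x - partialOwn f i z| ≤ L * ‖x - z‖)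
    (hG : ∀ i, ∀ x ∈ Metric.closedBall xs R, ‖fderiv ℝ (g i) x‖ ≤ G)
    (hG' : ∀ i, ∀ x ∈ Metric.closedBall xs R, ∀ z ∈ Metric.closedBall xs R,
      |g i x - g i z| ≤ G * ‖x - z‖)
    (hR : (√2 + √(2 * b')) * √B + 2 * B ≤ R)
    (hθ : 0 ≤ θ)
    (hθl : N ^ 2 * b * L + (N * L + N ^ 2 * b * L) ^ 2 / (2 * m) + 1 ≤ θ * l)
    (hA : 1 ≤ A) (hX : (2 + N * ab + 2 * b * N) * ((√2 + √(2 * b')) * √B) ≤ A / 4)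
    (hks : ∀ i, 1 ≤ ks i) (hK : ∀ i, ks i ≤ K) (hkc : ∀ i, ks i ≤ c i) (hθc : ∀ i, θ ≤ c i)
    (hGc : ∀ i, 4 * N * G ≤ c i) (hβ : ∀ i, 0 < β i)
    (hd₁ : ∀ t ∈ Ici t₀, ∀ i, |derivWithin (d i) (Ici t₀) t| ≤ M)
    (hd₂ : ∀ t ∈ Ici t₀, ∀ i, |iteratedDerivWithin 2 (d i) (Ici t₀) t| ≤ M)
    (hβ₁ : ∀ i, √(2 * B) * (2 * G + K * (1 / (4 * N))) ≤ 1 / (8 * N) * √(β i))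
    (hβ₂ : ∀ i, (G * L) ^ 2 ≤ 2 * ε' * β i)
    (hβ₃ : ∀ i, M * (1 / (4 * N) + 2) ≤ 1 / (8 * N) * β i) (hM : ∀ i, 2 * M ≤ β i)
    (hε₁ : A * (N * ε') * 2 ≤ m / 4) (hε₂ : A * (N * ε') * 2 ≤ 1 / 2) (hε' : 0 ≤ ε')
    (hκ : 0 ≤ κ) (hκ₁ : κ * (N / 2) ≤ m / 4) (hκ₂ : κ * (N ^ 2 * b / 2) ≤ 1 / 2)
    (hκ₃ : κ ≤ 1 / 6) {t : ℝ} (ht : t ∈ Ici t₀) {s : Fin N → ℝ}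
    (hs : ∀ i, s i ∈ sgnSet (S.zeta1 t i)) (hU : S.lyap g d θbar xs ks β A t₀ t ≤ B) :
    S.lyapRate f g d a θbar xs ks c β θ A t₀ t s ≤ -κ * S.lyap g d θbar xs ks β A t₀ t := by
  obtain ⟨hB0, hXB, hqB, hpB⟩ := norm_le_of_lyap_le hθbar hb' hb'0 hA hβ (hd₁ t ht) hM hU
  have hball : ‖S.errHat xs t‖ + ‖S.etaHat t‖ + ‖S.zeta1 t‖ ≤ R := by linarith
  obtain ⟨hxm, hxhm, hym⟩ := mem_closedBall_of_bounds hball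
  have hxsm : xs ∈ Metric.closedBall xs R :=
    Metric.mem_closedBall_self (le_trans (by positivity) hball)
  have hN' : (0 : ℝ) < N := by exact_mod_cast hN
  have hb0 : 0 ≤ b := (inv_nonneg.2 (hθbar ⟨0, hN⟩ ⟨0, hN⟩).le).trans (hb _ _)
  have hab0 : 0 ≤ ab := (ha ⟨0, hN⟩ ⟨0, hN⟩).trans (hab _ _)
  have hw : ∀ i, |partialOwn f i (S.y t i)| ≤ L * (‖S.errHat xs t‖ + ‖S.etaHat t‖) := by
    intro i
    have h1 := hL i _ (hym i) _ hxsm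
    have h0 : partialOwn f i xs = 0 := congrFun hxs i
    rw [h0, sub_zero] at h1
    refine h1.trans (mul_le_mul_of_nonneg_left ?_ hL0)
    have h2 : S.y t i - xs = S.errHat xs t + S.etaHat t i := by
      funext j
      simp only [errHat, etaHat, Pi.sub_apply, Pi.add_apply]
      ring
    rw [h2]
    exact (norm_add_le _ _).trans (add_le_add le_rfl (norm_le_pi_norm (S.etaHat t) i))
  have hew : m * ‖S.errHat xs t‖ ^ 2 - N * L * ‖S.errHat xs t‖ * ‖S.etaHat t‖ ≤
      ∑ i, S.errHat xs t i * partialOwn f i (S.y t i) := by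
    have h1 := hmono (S.xhat t) xs
    rw [hxs, sub_zero] at h1
    have h2 : m * ‖S.errHat xs t‖ ^ 2 ≤ m * ((S.xhat t - xs) ⬝ᵥ (S.xhat t - xs)) := by
      refine mul_le_mul_of_nonneg_left ((sq_norm_le_sum _).trans (le_of_eq ?_)) hm.le
      exact Finset.sum_congr rfl fun i _ => by simp only [errHat, Pi.sub_apply]; ring
    have h3 : ∑ i, S.errHat xs t i * partialOwn f i (S.y t i) =
        (S.xhat t - xs) ⬝ᵥ pseudoGradient f (S.xhat t) -
          ∑ i, S.errHat xs t i * (partialOwn f i (S.xhat t) - partialOwn f i (S.y t i)) := by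
      rw [dotProduct, ← Finset.sum_sub_distrib]
      exact Finset.sum_congr rfl fun i _ => by
        simp only [errHat, pseudoGradient, Pi.sub_apply]; ring
    have h4 : ∑ i, S.errHat xs t i * (partialOwn f i (S.xhat t) - partialOwn f i (S.y t i)) ≤
        ∑ _i : Fin N, ‖S.errHat xs t‖ * (L * ‖S.etaHat t‖) := by
      refine Finset.sum_le_sum fun i _ => (le_abs_self _).trans ?_
      rw [abs_mul]
      refine mul_le_mul (abs_le_pi_norm _ i) ?_ (abs_nonneg _) (norm_nonneg _)
      refine (hL i _ hxhm _ (hym i)).trans (mul_le_mul_of_nonneg_left ?_ hL0)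
      rw [norm_sub_rev]
      exact norm_le_pi_norm (S.etaHat t) i
    simp only [Finset.sum_const, Finset.card_univ, Fintype.card_fin, nsmul_eq_mul] at h4
    rw [h3]
    linarith
  have hc0 : ∀ i, 0 ≤ c i := fun i => zero_le_one.trans ((hks i).trans (hkc i))
  set Q := ∑ j, c j * |S.zeta1 t j| with hQ
  have hcq : ∀ i, c i * |S.zeta1 t i| ≤ Q := fun i =>
    Finset.single_le_sum (f := fun i => c i * |S.zeta1 t i|)
      (fun i _ => mul_nonneg (hc0 i) (abs_nonneg _)) (Finset.mem_univ i)
  have hQ0 : 0 ≤ Q := Finset.sum_nonneg fun i _ => mul_nonneg (hc0 i) (abs_nonneg _)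
  have hh : ∀ i, |S.gInc g t i| ≤ 1 / (4 * N) * Q := by
    intro i
    have h1 := abs_gInc_le hG' hball i
    -- The sup norm is attained at one component, and c ≥ 4NG there.
    have h2 : 4 * N * G * ‖S.zeta1 t‖ ≤ Q := by
      have : Nonempty (Fin N) := ⟨⟨0, hN⟩⟩
      obtain ⟨j, hj⟩ := Finite.exists_max fun j => ‖S.zeta1 t j‖
      have h3 : ‖S.zeta1 t‖ ≤ |S.zeta1 t j| := (pi_norm_le_iff_of_nonneg (norm_nonneg _)).2 hj
      calc 4 * N * G * ‖S.zeta1 t‖ ≤ c j * |S.zeta1 t j| :=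
            mul_le_mul (hGc j) h3 (norm_nonneg _) (hc0 j)
        _ ≤ Q := hcq j
    have h3 : 1 / (4 * (N : ℝ)) * (4 * N * G * ‖S.zeta1 t‖) = G * ‖S.zeta1 t‖ := by
      field_simp
    have h4 := mul_le_mul_of_nonneg_left h2 (by positivity : 0 ≤ 1 / (4 * (N : ℝ)))
    linarith
  have hK0 : 0 ≤ K := zero_le_one.trans ((hks ⟨0, hN⟩).trans (hK _))
  have hr : ∀ i, |S.pRemainder f g ks c t i| ≤ (2 * G + K * (1 / (4 * N))) * Q +
      G * L * (‖S.errHat xs t‖ + ‖S.etaHat t‖) := by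
    intro i
    have h1 : ‖S.xhatRate f ks c t‖ ≤ L * (‖S.errHat xs t‖ + ‖S.etaHat t‖) + 2 * Q := by
      refine (pi_norm_le_iff_of_nonneg (by positivity)).2 fun j => ?_
      rw [xhatRate, Real.norm_eq_abs]
      refine (abs_add_le _ _).trans (add_le_add ?_ ?_)
      · rw [abs_neg]; exact hw j
      · rw [abs_mul, abs_of_nonneg (by linarith [hks j, hc0 j])]
        nlinarith [hcq j, hkc j, abs_nonneg (S.zeta1 t j)]
    have h2 : |fderiv ℝ (g i) (S.xhat t) (S.xhatRate f ks c t)| ≤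
        G * (L * (‖S.errHat xs t‖ + ‖S.etaHat t‖) + 2 * Q) := by
      refine ((fderiv ℝ (g i) (S.xhat t)).le_opNorm _).trans ?_
      exact mul_le_mul (hG i _ hxhm) h1 (norm_nonneg _) hG0
    have h3 : |ks i * S.gInc g t i| ≤ K * (1 / (4 * N) * Q) := by
      rw [abs_mul, abs_of_nonneg (zero_le_one.trans (hks i))]
      exact mul_le_mul (hK i) (hh i) (abs_nonneg _) hK0
    rw [pRemainder]
    refine (abs_sub _ _).trans ?_
    linarith
  have hX' : (2 + N * ab + 2 * b * N) * (‖S.errHat xs t‖ + ‖S.etaHat t‖) ≤ A / 4 :=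
    le_trans (by gcongr) hX
  have hδ : (N : ℝ) * (1 / (4 * N) + 2 * (1 / (8 * N))) ≤ 1 / 2 := by
    refine le_of_eq ?_
    field_simp
    norm_num
  exact lyapunov_rate_le hN hθbar hb ha hab hl hl0 hθ hm hθl hew hw (zero_le_one.trans hA) hX'
    hks hkc hθc hβ (fun i => mul_self_eq_abs_of_mem_sgnSet (hs i))
    (fun i => abs_le_one_of_mem_sgnSet (hs i)) hh hr hpB (hd₁ t ht) (hd₂ t ht)
    (by positivity) hβ₁ hβ₂ hβ₃ hM hδ hε₁ hε₂ hε' hκ hκ₁ hκ₂ hκ₃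

/-- The original errors are linear combinations of the observer coordinates and the increment of g,
for instance ζ₂ = p + (g(x) - g(x̂)) + kˢ ζ₁. -/
theorem IsSolution.norm_error_le (hS : S.IsSolution f g d a θbar θ ks c β t₀ J)
    (hJ : UniqueDiffOn ℝ J) {t : ℝ} (ht : t ∈ J) (hG : 0 ≤ G) (hK : 0 ≤ K)
    (hks : ∀ i, |ks i| ≤ K) (he : ‖S.errHat xs t‖ ≤ ρ) (hη : ‖S.etaHat t‖ ≤ ρ)
    (hq : ‖S.zeta1 t‖ ≤ ρ) (hp : ∀ i, |S.pHat g d ks t i| ≤ ρ)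
    (hh : ∀ i, |S.gInc g t i| ≤ G * ‖S.zeta1 t‖) :
    ‖S.error g d xs c J t‖ ≤
      √(Fintype.card (Fin N ⊕ Fin N ⊕ Fin N ⊕ (Fin N × Fin N) ⊕ Fin N)) *
        ((2 + G + K) * ρ) := by
  have hρ : 0 ≤ ρ := (norm_nonneg _).trans he
  have hGρ : 0 ≤ G * ρ := mul_nonneg hG hρ
  have hKρ : 0 ≤ K * ρ := mul_nonneg hK hρ
  have hq' : ∀ i, |S.zeta1 t i| ≤ ρ := fun i => (abs_le_pi_norm _ i).trans hq
  have hh' : ∀ i, |S.gInc g t i| ≤ G * ρ := fun i =>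
    (hh i).trans (mul_le_mul_of_nonneg_left hq hG)
  have hcomp : ∀ k, ‖S.error g d xs c J t k‖ ≤ (2 + G + K) * ρ := by
    rintro (i | i | i | ⟨i, j⟩ | i)
    · change |S.zeta1 t i| ≤ _
      linarith [hq' i]
    · change |S.zeta2 g d t i| ≤ _
      have e : S.zeta2 g d t i = S.pHat g d ks t i + S.gInc g t i + ks i * S.zeta1 t i := by
        simp only [zeta2, pHat, gInc]; ring
      have h1 : |ks i * S.zeta1 t i| ≤ K * ρ := by
        rw [abs_mul]; exact mul_le_mul (hks i) (hq' i) (abs_nonneg _) hK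
      rw [e]
      linarith [abs_add_le (S.pHat g d ks t i + S.gInc g t i) (ks i * S.zeta1 t i),
        abs_add_le (S.pHat g d ks t i) (S.gInc g t i), hp i, hh' i]
    · change |S.xi xs t i| ≤ _
      have e : S.xi xs t i = S.errHat xs t i + S.zeta1 t i := by
        simp only [xi, errHat, zeta1]; ring
      rw [e]
      linarith [abs_add_le (S.errHat xs t i) (S.zeta1 t i), hq' i, abs_le_pi_norm (S.errHat xs t) i]
    · change |S.eta t i j| ≤ _
      have e : S.eta t i j = S.etaHat t i j - S.zeta1 t j := by
        simp only [eta, etaHat, zeta1]; ring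
      rw [e]
      linarith [abs_sub (S.etaHat t i j) (S.zeta1 t j), hq' j, abs_le_pi_norm₂ (S.etaHat t) i j]
    · change |S.gamma c J t i| ≤ _
      rw [hS.gamma_eq hJ ht]
      linarith [abs_add_le (S.pHat g d ks t i) (S.gInc g t i), hp i, hh' i]
  rw [EuclideanSpace.norm_eq]
  calc √(∑ k, ‖S.error g d xs c J t k‖ ^ 2)
      ≤ √(Fintype.card (Fin N ⊕ Fin N ⊕ Fin N ⊕ (Fin N × Fin N) ⊕ Fin N) *
          ((2 + G + K) * ρ) ^ 2) := by
        refine Real.sqrt_le_sqrt ?_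
        refine (Finset.sum_le_sum fun k _ =>
          pow_le_pow_left₀ (norm_nonneg _) (hcomp k) 2).trans (le_of_eq ?_)
        simp only [Finset.sum_const, Finset.card_univ, nsmul_eq_mul]
    _ = _ := by rw [Real.sqrt_mul (Nat.cast_nonneg _), Real.sqrt_sq (by positivity)]

/-- The initial value of the Lyapunov function, in terms of the initial error. -/
theorem IsSolution.lyap_initial_le (hS : S.IsSolution f g d a θbar θ ks c β t₀ J)
    (hJ : UniqueDiffOn ℝ J) (hN : 0 < N) (ht : t₀ ∈ J) (hθbar : ∀ i j, 0 < θbar i j)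
    (hb : ∀ i j, (θbar i j)⁻¹ ≤ b) (hA : 0 ≤ A) (hβ : ∀ i, 0 < β i)
    (hd₁ : ∀ i, |derivWithin (d i) (Ici t₀) t₀| ≤ M) (hM : ∀ i, 2 * M ≤ β i)
    {R v : ℝ} (hv : 0 ≤ v) (hR : 5 * v ≤ R) (hG0 : 0 ≤ G)
    (hG : ∀ i, ∀ x ∈ Metric.closedBall xs R, ∀ z ∈ Metric.closedBall xs R,
      |g i x - g i z| ≤ G * ‖x - z‖)
    (hβv : ∀ i, v * (1 + G) ^ 2 ≤ β i) (he : ‖S.error g d xs c J t₀‖ ≤ v) :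
    S.lyap g d θbar xs ks β A t₀ t₀ ≤ (2 * N + 2 * N ^ 2 * b) * v ^ 2 + 2 * N * v * A := by
  have hcomp : ∀ k, |S.error g d xs c J t₀ k| ≤ v := fun k =>
    (PiLp.norm_apply_le (S.error g d xs c J t₀) k).trans he
  have hq : ∀ i, |S.zeta1 t₀ i| ≤ v := fun i => hcomp (Sum.inl i)
  have hξ : ∀ i, |S.xi xs t₀ i| ≤ v := fun i => hcomp (Sum.inr (Sum.inr (Sum.inl i)))
  have hη : ∀ i j, |S.eta t₀ i j| ≤ v := fun i j =>
    hcomp (Sum.inr (Sum.inr (Sum.inr (Sum.inl (i, j)))))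
  have hγ : ∀ i, |S.gamma c J t₀ i| ≤ v := fun i =>
    hcomp (Sum.inr (Sum.inr (Sum.inr (Sum.inr i))))
  have hq' : ‖S.zeta1 t₀‖ ≤ v := (pi_norm_le_iff_of_nonneg hv).2 hq
  have he' : ‖S.errHat xs t₀‖ ≤ 2 * v := (pi_norm_le_iff_of_nonneg (by positivity)).2 fun i => by
    have e : S.errHat xs t₀ i = S.xi xs t₀ i - S.zeta1 t₀ i := by
      simp only [xi, errHat, zeta1]; ring
    rw [e, Real.norm_eq_abs]
    linarith [abs_sub (S.xi xs t₀ i) (S.zeta1 t₀ i), hq i, hξ i]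
  have hη' : ‖S.etaHat t₀‖ ≤ 2 * v := (pi_norm_le_iff_of_nonneg (by positivity)).2 fun i =>
    (pi_norm_le_iff_of_nonneg (by positivity)).2 fun j => by
      have e : S.etaHat t₀ i j = S.eta t₀ i j + S.zeta1 t₀ j := by
        simp only [eta, etaHat, zeta1]; ring
      rw [e, Real.norm_eq_abs]
      linarith [abs_add_le (S.eta t₀ i j) (S.zeta1 t₀ j), hq j, hη i j]
  have hp : ∀ i, |S.pHat g d ks t₀ i| ≤ v * (1 + G) := by
    intro i
    have e : S.pHat g d ks t₀ i = S.gamma c J t₀ i - S.gInc g t₀ i := by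
      rw [hS.gamma_eq hJ ht]; ring
    have h1 := abs_gInc_le hG (by linarith : ‖S.errHat xs t₀‖ + ‖S.etaHat t₀‖ + ‖S.zeta1 t₀‖ ≤ R) i
    have h2 : G * ‖S.zeta1 t₀‖ ≤ G * v := by gcongr
    rw [e]
    linarith [abs_sub (S.gamma c J t₀ i) (S.gInc g t₀ i), hγ i]
  -- Large β hides the initial size of p, so the bound on the initial energy involves neither the
  -- gains nor G. This keeps B independent of G, whose ball depends on B.
  have hp2 : ∀ i, S.pHat g d ks t₀ i ^ 2 / (2 * β i) ≤ v / 2 := by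
    intro i
    rw [div_le_iff₀ (by linarith [hβ i]), ← sq_abs]
    calc |S.pHat g d ks t₀ i| ^ 2 ≤ (v * (1 + G)) ^ 2 := by
          gcongr
          exact hp i
      _ = v * (v * (1 + G) ^ 2) := by ring
      _ ≤ v * β i := mul_le_mul_of_nonneg_left (hβv i) hv
      _ = _ := by ring
  have hb0 : 0 ≤ b := (inv_nonneg.2 (hθbar ⟨0, hN⟩ ⟨0, hN⟩).le).trans (hb _ _)
  have hsum₁ : ∑ i, S.pHat g d ks t₀ i ^ 2 / (2 * β i) ≤ N * (v / 2) := by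
    refine (Finset.sum_le_sum fun i _ => hp2 i).trans (le_of_eq ?_)
    simp only [Finset.sum_const, Finset.card_univ, Fintype.card_fin, nsmul_eq_mul]
  have hsum₂ : ∑ i, |S.zeta1 t₀ i| ≤ N * v := by
    refine (Finset.sum_le_sum fun i _ => hq i).trans (le_of_eq ?_)
    simp only [Finset.sum_const, Finset.card_univ, Fintype.card_fin, nsmul_eq_mul]
  calc S.lyap g d θbar xs ks β A t₀ t₀
      ≤ N / 2 * ‖S.errHat xs t₀‖ ^ 2 + N ^ 2 * b / 2 * ‖S.etaHat t₀‖ ^ 2 +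
        A * (∑ i, S.pHat g d ks t₀ i ^ 2 / (2 * β i) + 3 / 2 * ∑ i, |S.zeta1 t₀ i|) :=
        lyapunov_le hN hθbar hb hA hβ hd₁ hM
    _ ≤ N / 2 * (2 * v) ^ 2 + N ^ 2 * b / 2 * (2 * v) ^ 2 +
        A * (N * (v / 2) + 3 / 2 * (N * v)) := by gcongr
    _ = _ := by ring

end Trajectory

/-! ### Choice of the constants and the main theorem. -/

theorem exists_gain (k b₀ b₁ : ℝ) (hb₀ : 0 ≤ b₀) (hb₁ : 0 ≤ b₁) :
    ∃ A : ℝ, 1 ≤ A ∧ k * √(b₀ + b₁ * A) ≤ A := by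
  refine ⟨1 + k ^ 2 * (b₀ + b₁), by nlinarith [mul_nonneg (sq_nonneg k) (add_nonneg hb₀ hb₁)], ?_⟩
  set A := 1 + k ^ 2 * (b₀ + b₁) with hA
  have hA1 : 1 ≤ A := by nlinarith [mul_nonneg (sq_nonneg k) (add_nonneg hb₀ hb₁)]
  have h0 : 0 ≤ b₀ + b₁ * A := by positivity
  refine abs_le_of_sq_le_sq' ?_ (by linarith) |>.2
  rw [mul_pow, Real.sq_sqrt h0]
  have h1 : b₀ + b₁ * A ≤ (b₀ + b₁) * A := by nlinarith
  calc k ^ 2 * (b₀ + b₁ * A) ≤ k ^ 2 * ((b₀ + b₁) * A) := by gcongr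
    _ = (A - 1) * A := by rw [hA]; ring
    _ ≤ A ^ 2 := by nlinarith

theorem exists_upper_bound {ι : Type*} [Fintype ι] (u : ι → ℝ) :
    ∃ C : ℝ, 0 < C ∧ ∀ i, u i ≤ C := by
  refine ⟨∑ i, |u i| + 1, ?_, fun i => ?_⟩
  · have : 0 ≤ ∑ i, |u i| := Finset.sum_nonneg fun i _ => abs_nonneg _
    linarith
  · have := Finset.single_le_sum (f := fun i => |u i|) (fun i _ => abs_nonneg _) (Finset.mem_univ i)
    linarith [le_abs_self (u i)]

end RISE

set_option maxHeartbeats 1000000 in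
theorem theorem2 {N : ℕ} (hN : 2 ≤ N)
    (f g : Fin N → (Fin N → ℝ) → ℝ) (d : Fin N → ℝ → ℝ)
    (a θbar : Matrix (Fin N) (Fin N) ℝ) (t₀ : ℝ)
    (hf : ∀ i, ContDiff ℝ 2 (f i))
    (hmono : ∃ m : ℝ, 0 < m ∧ ∀ x z : Fin N → ℝ,
      m * ((x - z) ⬝ᵥ (x - z)) ≤
        (x - z) ⬝ᵥ (RISE.pseudoGradient f x - RISE.pseudoGradient f z))
    (ha : RISE.IsUndirectedConnected a)
    (hg : ∀ i, ContDiff ℝ 2 (g i))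
    (hd : ∀ i, ContDiffOn ℝ 2 (d i) (Set.Ici t₀))
    (hdb : ∀ i, ∃ M : ℝ, ∀ t ∈ Set.Ici t₀,
      |derivWithin (d i) (Set.Ici t₀) t| ≤ M ∧
      |iteratedDerivWithin 2 (d i) (Set.Ici t₀) t| ≤ M)
    (hθbar : ∀ i j, 0 < θbar i j) :
    (∃! xs, RISE.IsNash f xs) ∧
    ∀ xs, RISE.IsNash f xs →
      ∀ v₁ : ℝ, 0 < v₁ →
      ∃ θs : ℝ, 0 < θs ∧ ∀ θ : ℝ, θs < θ →
      ∃ kr : ℝ, 0 < kr ∧ ∀ ks : Fin N → ℝ, (∀ i, kr < ks i) →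
      ∃ cr : ℝ, 0 < cr ∧ ∀ c : Fin N → ℝ, (∀ i, cr < c i) →
      ∃ βr : ℝ, 0 < βr ∧ ∀ β : Fin N → ℝ, (∀ i, βr < β i) →
        -- no solution escapes in finite time
        (∀ (T : ℝ), t₀ < T → ∀ S : RISE.Trajectory N,
          S.IsSolution f g d a θbar θ ks c β t₀ (Set.Ico t₀ T) →
          ‖S.error g d xs c (Set.Ico t₀ T) t₀‖ ≤ v₁ →
          ∃ C : ℝ, ∀ t ∈ Set.Ico t₀ T, ‖S.error g d xs c (Set.Ico t₀ T) t‖ ≤ C) ∧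
        -- the error tends to zero along every solution
        (∀ S : RISE.Trajectory N,
          S.IsSolution f g d a θbar θ ks c β t₀ (Set.Ici t₀) →
          ‖S.error g d xs c (Set.Ici t₀) t₀‖ ≤ v₁ →
          Filter.Tendsto (fun t => ‖S.error g d xs c (Set.Ici t₀) t‖) Filter.atTop (nhds 0)) := by
  open RISE Set Filter Topology in
  obtain ⟨m, hm, hmono⟩ := hmono
  refine ⟨existsUnique_isNash hf hm hmono, fun xs hNash v hv => ?_⟩
  have hxs := hNash.pseudoGradient_eq_zero hf
  have hN0 : 0 < N := by omega
  have hN' : (0 : ℝ) < N := by exact_mod_cast hN0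
  obtain ⟨l, hl0, hl⟩ := ha.exists_coercive hN
  obtain ⟨b, hb0, hb⟩ := exists_upper_bound fun ij : Fin N × Fin N => (θbar ij.1 ij.2)⁻¹
  obtain ⟨b', hb'0, hb'⟩ := exists_upper_bound fun ij : Fin N × Fin N => θbar ij.1 ij.2
  obtain ⟨ab, hab0, hab⟩ := exists_upper_bound fun ij : Fin N × Fin N => a ij.1 ij.2
  choose Md hMd using hdb
  obtain ⟨M, hM0, hM⟩ := exists_upper_bound Md
  have hd₁ : ∀ t ∈ Ici t₀, ∀ i, |derivWithin (d i) (Ici t₀) t| ≤ M := fun t ht i =>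
    (hMd i t ht).1.trans (hM i)
  have hd₂ : ∀ t ∈ Ici t₀, ∀ i, |iteratedDerivWithin 2 (d i) (Ici t₀) t| ≤ M := fun t ht i =>
    (hMd i t ht).2.trans (hM i)
  -- The argument of the square root is the future barrier B as an affine function of A; its summand
  -- 1 makes the initial value strictly smaller than B.
  obtain ⟨A, hA, hAk⟩ := exists_gain (4 * ((2 + N * ab + 2 * b * N) * (√2 + √(2 * b'))))
    ((2 * N + 2 * N ^ 2 * b) * v ^ 2 + 1) (2 * N * v) (by positivity) (by positivity)
  have hA0 : 0 < A := by linarith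
  set B := (2 * N + 2 * N ^ 2 * b) * v ^ 2 + 1 + 2 * N * v * A with hB
  have hB0 : 0 < B := by positivity
  -- The first two terms cover all states with energy at most B; 5v covers the initial state, where
  -- the norms of e, η, q are at most 2v, 2v, v.
  set R := (√2 + √(2 * b')) * √B + 2 * B + 5 * v with hR
  have hR5 : 5 * v ≤ R := by
    have : 0 ≤ (√2 + √(2 * b')) * √B + 2 * B := by positivity
    linarith
  obtain ⟨L, hL0, hL⟩ := exists_lipschitz_on_closedBall
    (fun i => contDiff_partialOwn (hf i)) xs R
  obtain ⟨G, hG0, hG⟩ := exists_lipschitz_on_closedBall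
    (fun i => (hg i).of_le one_le_two) xs R
  have hθnum : 0 < N ^ 2 * b * L + (N * L + N ^ 2 * b * L) ^ 2 / (2 * m) + 1 := by positivity
  refine ⟨(N ^ 2 * b * L + (N * L + N ^ 2 * b * L) ^ 2 / (2 * m) + 1) / l, by positivity,
    fun θ hθ => ?_⟩
  have hθl := ((div_lt_iff₀ hl0).1 hθ).le
  have hθ0 : 0 < θ := lt_trans (by positivity) hθ
  -- Only kˢ ≥ 1 is needed: the remainder in the equation for p is made harmless by β, not by kˢ.
  refine ⟨1, one_pos, fun ks hks => ?_⟩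
  obtain ⟨K, hK0, hK⟩ := exists_upper_bound ks
  refine ⟨K + θ + 4 * N * G, by positivity, fun c hc => ?_⟩
  have hGN : 0 ≤ 4 * N * G := by positivity
  -- Chosen so that the Young remainder, weighted by A and summed over the players, fits the slack
  -- m/4 and 1/2 in the seeking budget.
  set ε' := min (m / 4) (1 / 2) / (2 * (A * N)) with hε'
  have hε'0 : 0 < ε' := by positivity
  have hεA : A * (N * ε') * 2 = min (m / 4) (1 / 2) := by
    rw [hε']
    field_simp
  set P := √(2 * B) * (2 * G + K * (1 / (4 * N))) with hP
  have hP0 : 0 ≤ P := by positivity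
  -- The summands handle, in order, the parts of p r/β proportional to Q and to ‖e‖ + ‖η‖, the
  -- disturbance terms, positivity of the energy, and the initial size of p.
  refine ⟨(8 * N * P) ^ 2 + (G * L) ^ 2 / (2 * ε') + 8 * N * (M * (1 / (4 * N) + 2)) + 2 * M +
    v * (1 + G) ^ 2, by positivity, fun β hβ => ?_⟩
  have s1 : 0 ≤ (8 * N * P) ^ 2 := by positivity
  have s2 : 0 ≤ (G * L) ^ 2 / (2 * ε') := by positivity
  have s3 : 0 ≤ 8 * N * (M * (1 / (4 * N) + 2)) := by positivity
  have s5 : 0 ≤ v * (1 + G) ^ 2 := by positivity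
  have hβ0 : ∀ i, 0 < β i := fun i => by linarith [hβ i]
  have hβ₁ : ∀ i, P ≤ 1 / (8 * N) * √(β i) := by
    intro i
    have h1 : 8 * N * P ≤ √(β i) := Real.le_sqrt_of_sq_le (by linarith [hβ i])
    rw [one_div, inv_mul_eq_div, le_div_iff₀ (by positivity)]
    linarith
  have hβ₂ : ∀ i, (G * L) ^ 2 ≤ 2 * ε' * β i := by
    intro i
    have h1 : (G * L) ^ 2 / (2 * ε') ≤ β i := by linarith [hβ i]
    rw [div_le_iff₀ (by positivity)] at h1
    linarith
  have hβ₃ : ∀ i, M * (1 / (4 * N) + 2) ≤ 1 / (8 * N) * β i := by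
    intro i
    have h1 : 8 * N * (M * (1 / (4 * N) + 2)) ≤ β i := by linarith [hβ i]
    rw [one_div (8 * (N : ℝ)), inv_mul_eq_div, le_div_iff₀ (by positivity)]
    linarith
  have hβM : ∀ i, 2 * M ≤ β i := fun i => by linarith [hβ i]
  have hβv : ∀ i, v * (1 + G) ^ 2 ≤ β i := fun i => by linarith [hβ i]
  set κ := min (m / 4 / (N / 2)) (min (1 / 2 / (N ^ 2 * b / 2)) (1 / 6)) with hκ
  have hκ0 : 0 < κ := by positivity
  have hκ₁ : κ * (N / 2) ≤ m / 4 := (le_div_iff₀ (by positivity)).1 (min_le_left _ _)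
  have hκ₂ : κ * (N ^ 2 * b / 2) ≤ 1 / 2 :=
    (le_div_iff₀ (by positivity)).1 ((min_le_right _ _).trans (min_le_left _ _))
  have hκ₃ : κ ≤ 1 / 6 := (min_le_right _ _).trans (min_le_right _ _)
  obtain ⟨Bβ, hBβ0, hBβ⟩ := exists_upper_bound fun i => √(β i)
  let ρ : ℝ → ℝ := fun U => (√2 + √(2 * b')) * √U + 2 * U + √(2 * U) * Bβ
  let D : ℝ := √(Fintype.card (Fin N ⊕ Fin N ⊕ Fin N ⊕ (Fin N × Fin N) ⊕ Fin N))
  have core : ∀ (J : Set ℝ) (S : Trajectory N), UniqueDiffOn ℝ J → J ⊆ Ici t₀ → t₀ ∈ J →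
      (∀ t ∈ J, Icc t₀ t ⊆ J) → S.IsSolution f g d a θbar θ ks c β t₀ J →
      ‖S.error g d xs c J t₀‖ ≤ v → ∃ U₀, 0 ≤ U₀ ∧ ∀ t ∈ J,
        ‖S.error g d xs c J t‖ ≤ D * ((2 + G + K) * ρ (U₀ * Real.exp (-κ * (t - t₀)))) := by
    intro J S hJu hJ ht₀ hJI hS herr
    have hinit := hS.lyap_initial_le (θbar := θbar) (A := A) (M := M) (b := b) hJu hN0 ht₀ hθbar
      (fun i j => hb (i, j)) hA0.le hβ0 (hd₁ t₀ self_mem_Ici) hβM hv.le hR5 hG0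
      (fun i => (hG i).2) hβv herr
    have hltB : S.lyap g d θbar xs ks β A t₀ t₀ < B := by linarith
    -- The bounds are applied with the energy's own value as the level.
    have hnonneg : 0 ≤ S.lyap g d θbar xs ks β A t₀ t₀ :=
      (Trajectory.norm_le_of_lyap_le hθbar (fun i j => hb' (i, j)) hb'0.le hA hβ0
        (hd₁ t₀ self_mem_Ici) hβM le_rfl).1
    refine ⟨_, hnonneg, fun t ht => ?_⟩
    have htt : t₀ ≤ t := hJ ht
    have hdecay := hS.lyap_decay hf hg hd (xs := xs) (A := A) hκ0.le hnonneg hltB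
      (fun t ht s hs hU => Trajectory.lyapRate_le hN0 hm hmono hxs hθbar
        (fun i j => hb (i, j)) (fun i j => hb' (i, j)) hb'0.le ha.nonneg (fun i j => hab (i, j))
        hl hl0.le hL0 hG0 (fun i => (hL i).2) (fun i => (hG i).1) (fun i => (hG i).2)
        (by linarith) hθ0.le hθl hA (by linarith) (fun i => (hks i).le) hK
        (fun i => by linarith [hc i, hK i]) (fun i => by linarith [hc i]) (fun i => by linarith [hc i])
        hβ0 hd₁ hd₂ hβ₁ hβ₂ hβ₃ hβM (hεA.trans_le (min_le_left _ _))
        (hεA.trans_le (min_le_right _ _)) hε'0.le hκ0.le hκ₁ hκ₂ hκ₃ ht hs hU) ht htt (hJI t ht)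
    have hexp : Real.exp (-κ * (t - t₀)) ≤ 1 :=
      Real.exp_le_one_iff.2 (by
        rw [neg_mul]
        exact neg_nonpos.2 (mul_nonneg hκ0.le (sub_nonneg.2 htt)))
    -- The level B is used to stay inside the ball; the decaying level is used next for the actual
    -- size of the error.
    obtain ⟨-, hXB, hqB, -⟩ := Trajectory.norm_le_of_lyap_le hθbar (fun i j => hb' (i, j)) hb'0.le
      hA hβ0 (hd₁ t htt) hβM
      (hdecay.trans ((mul_le_of_le_one_right hnonneg hexp).trans hltB.le))
    obtain ⟨hU0, hX, hq, hp⟩ := Trajectory.norm_le_of_lyap_le hθbar (fun i j => hb' (i, j)) hb'0.le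
      hA hβ0 (hd₁ t htt) hβM hdecay
    set U := S.lyap g d θbar xs ks β A t₀ t₀ * Real.exp (-κ * (t - t₀))
    have r1 : 0 ≤ (√2 + √(2 * b')) * √U := by positivity
    have r2 : 0 ≤ √(2 * U) * Bβ := by positivity
    refine hS.norm_error_le hJu ht hG0 hK0.le
      (fun i => (abs_of_pos (one_pos.trans (hks i))).trans_le (hK i)) ?_ ?_ ?_ (fun i => ?_)
      (Trajectory.abs_gInc_le (fun i => (hG i).2) (by linarith))
    · change _ ≤ (√2 + √(2 * b')) * √U + 2 * U + √(2 * U) * Bβ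
      linarith [norm_nonneg (S.etaHat t)]
    · change _ ≤ (√2 + √(2 * b')) * √U + 2 * U + √(2 * U) * Bβ
      linarith [norm_nonneg (S.errHat xs t)]
    · change _ ≤ (√2 + √(2 * b')) * √U + 2 * U + √(2 * U) * Bβ
      linarith
    · change _ ≤ (√2 + √(2 * b')) * √U + 2 * U + √(2 * U) * Bβ
      have := mul_le_mul_of_nonneg_left (hBβ i) (Real.sqrt_nonneg (2 * U))
      linarith [hp i]
  refine ⟨fun T hT S hS herr => ?_, fun S hS herr => ?_⟩
  · obtain ⟨U₀, hU₀, h⟩ := core _ S (uniqueDiffOn_Ico t₀ T) Ico_subset_Ici_self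
      ⟨le_rfl, hT⟩ (fun t ht => Icc_subset_Ico_right ht.2) hS herr
    refine ⟨D * ((2 + G + K) * ρ U₀), fun t ht => (h t ht).trans ?_⟩
    have hexp : Real.exp (-κ * (t - t₀)) ≤ 1 :=
      Real.exp_le_one_iff.2 (by
        rw [neg_mul]
        exact neg_nonpos.2 (mul_nonneg hκ0.le (sub_nonneg.2 ht.1)))
    have hle : U₀ * Real.exp (-κ * (t - t₀)) ≤ U₀ := mul_le_of_le_one_right hU₀ hexp
    have hρ : ρ (U₀ * Real.exp (-κ * (t - t₀))) ≤ ρ U₀ := by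
      change _ * √_ + 2 * _ + √(2 * _) * Bβ ≤ _ * √_ + 2 * _ + √(2 * _) * Bβ
      gcongr
    gcongr
  · obtain ⟨U₀, hU₀, h⟩ := core _ S (uniqueDiffOn_Ici t₀) Subset.rfl
      self_mem_Ici (fun t ht => Icc_subset_Ici_self) hS herr
    have hlim : Tendsto (fun t => U₀ * Real.exp (-κ * (t - t₀))) atTop (𝓝 0) := by
      have h1 : Tendsto (fun t : ℝ => -κ * (t - t₀)) atTop atBot :=
        (tendsto_atTop_add_const_right _ _ tendsto_id).const_mul_atTop_of_neg (neg_neg_of_pos hκ0)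
      simpa using (Real.tendsto_exp_atBot.comp h1).const_mul U₀
    have hρc : Continuous ρ := by fun_prop
    have hρ0 : ρ 0 = 0 := by simp [ρ]
    have hlim2 : Tendsto (fun t => D * ((2 + G + K) * ρ (U₀ * Real.exp (-κ * (t - t₀))))) atTop
        (𝓝 0) := by
      have h2 := (hρc.tendsto 0).comp hlim
      rw [hρ0] at h2
      simpa using (h2.const_mul (2 + G + K)).const_mul D
    refine squeeze_zero' (Eventually.of_forall fun t => norm_nonneg _) ?_ hlim2
    filter_upwards [eventually_ge_atTop t₀] with t ht
    exact h t ht
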